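/- Let $C_v\in\mathbb R^{n\times n}$ denote the circulant matrix with first column $v\in\mathbb R^n$, let $\circledast$ be circular convolution on $\mathbb R^n$, let $e_1,\dots,e_n$ be the standard basis, and let $\|\cdot\|$ be the Euclidean norm. Let $x_1,\dots,x_N$ be random vectors in $\mathbb R^n$ with entries $x_{i(j)}=A_{ij}B_{ij}$, where all $A_{ij},B_{ij}$ ($i\le N$, $j\le n$) are independent, $A_{ij}$ is uniform on $\{1,-1\}$ and $B_{ij}$ is Bernoulli with parameter $\theta$. Let $f\in\mathbb R^n$ be such that $f\circledast g=e_1$ for some $g\in\mathbb R^n$, let $\kappa$ be the ratio of the largest to the smallest magnitude of the discrete Fourier transform of $f$, and put $y_i=x_i\circledast f$. Define $$R=\Bigl(\frac1{\theta nN}\sum_{i=1}^N C_{y_i}^\top C_{y_i}\Bigr)^{-1/2},\qquad L(h)=-\frac1{4N}\sum_{i=1}^N\|C_{y_i}Rh\|_4^4 .$$ For a function $F$ on $\mathbb R^n$ and a point $h$ of the unit sphere $S^{n-1}$, with $P_{h^\perp}=I-hh^\top$, the Riemannian gradient and Hessian are $\widehat\nabla_F(h)=P_{h^\perp}\nabla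 F(h)$ and $\widehat H_F(h)=P_{h^\perp}\nabla^2F(h)P_{h^\perp}-\langle\nabla F(h),h\rangle P_{h^\perp}$; $h$ is stationary for $F$ if $\widehat\nabla_F(h)=0$, and a stationary point is a strict saddle if $\widehat H_F(h)$ has a strictly negative eigenvalue. For $\rho>0$ define subsets of $S^{n-1}$ as follows. Let $L''(h)=-\frac1{4N}\sum_{i=1}^N\|C_{x_i}h\|_4^4$. The $(\rho,r)$-neighborhood of a stationary point $h_0\in S^{n-1}$ of $\mathbb E L''$ with exactly $r$ nonzero entries is the set of $h\in S^{n-1}$ with $\max_j|h_{(j)}^2-h_{0(j)}^2|\le\rho/r$. Let $\mathcal H_1''$ be the union of the $(\rho,1)$-neighborhoods of the stationary points of $\mathbb E L''$ with one nonzero entry, $\mathcal H_2''$ the union of the $(\rho,r)$-neighborhoods of those with $r>1$ nonzero entries, over all $r>1$, and $\mathcal H_3''=S^{n-1}\setminus(\mathcal H_1''\cup\mathcal H_2'')$. Put $\mathcal H_k=(C_f^\top C_f)^{1/2}C_f^{-1}\mathcal H_k''$ for $k=1,2,3$, and $c=\theta(1-3\theta)\rho^2/(2n)$. Theorem. For every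 $\theta<\frac13$ there are constants $c_1,c_1'>0$, depending only on $\theta$, such that the following holds for all $n,N\ge1$ with $\frac1n\le\theta$, all $0<\rho<10^{-3}$ and all $f$ and $x_1,\dots,x_N$ as above. If $$N>\max\Bigl\{\frac{c_1n^9}{\rho^4}\log\frac n\rho,\ \frac{c_1\kappa^8n^8}{\rho^4}\log n\Bigr\},$$ then $c>0$, the sets $\mathcal H_1,\mathcal H_2,\mathcal H_3$ are pairwise disjoint with union $S^{n-1}$, and there is an event of probability at least $1-n^{-c_1'}$ on which all of the following hold. 1. The matrix $\frac1{\theta nN}\sum_i C_{y_i}^\top C_{y_i}$ is positive definite, so that $R$ is well defined. 2. For every local minimum $h^*$ of $L$ on $S^{n-1}$ there is $j$ such that $\|C_fRh^*-e_j\|\le2\sqrt\rho$ or $\|C_fRh^*+e_j\|\le2\sqrt\rho$. 3. For every $h\in\mathcal H_1$, $\min_{\|z\|=1,\,z\perp h}z^\top\widehat H_L(h)z\ge c$. 4. For every $h\in\mathcal H_2$, $\min_{\|z\|=1,\,z\perp h}z^\top\widehat H_L(h)z\le-c$. 5. For every $h\in\mathcal H_3$, $\|\widehat\nabla_L(h)\|\ge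 c$. 6. Every stationary point of $L$ on $S^{n-1}$ lies in $\mathcal H_1$ or $\mathcal H_2$; those in $\mathcal H_1$ are local minima of $L$ on $S^{n-1}$, and those in $\mathcal H_2$ are strict saddles. -/

import Mathlib

open MeasureTheory ProbabilityTheory

namespace MSBD

noncomputable section

/-- `ℝⁿ` with the Euclidean norm; the coordinates are indexed by the integers modulo `n`. -/
abbrev Vec (n : ℕ) [NeZero n] : Type := EuclideanSpace ℝ (ZMod n)

section Calculus

variable {n : ℕ} [NeZero n]

/-- The unit sphere `S^{n-1}`. -/
def unitSphere (n : ℕ) [NeZero n] : Set (Vec n) := {h | ‖h‖ = 1}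

/-- `P_{h^⊥} = I - h hᵀ`. -/
def tangentProj (h : Vec n) : Vec n →L[ℝ] Vec n :=
  ContinuousLinearMap.id ℝ (Vec n) - (innerSL ℝ h).smulRight h

/-- The Riemannian gradient `P_{h^⊥} ∇F(h)` on the sphere. -/
def riemGrad (F : Vec n → ℝ) (h : Vec n) : Vec n :=
  tangentProj h (gradient F h)

/-- The Riemannian Hessian `P_{h^⊥} H_F(h) P_{h^⊥} - ⟨∇F(h), h⟩ P_{h^⊥}` on the sphere, where the
Euclidean Hessian `H_F(h)` is the derivative of the gradient field. -/
def riemHess (F : Vec n → ℝ) (h : Vec n) : Vec n →L[ℝ] Vec n :=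
  tangentProj h ∘L fderiv ℝ (gradient F) h ∘L tangentProj h
    - inner ℝ (gradient F h) h • tangentProj h

/-- The values `zᵀ Ĥ_F(h) z` over unit tangent vectors `z ⊥ h`. -/
def tangentCurvatures (F : Vec n → ℝ) (h : Vec n) : Set ℝ :=
  {q | ∃ z : Vec n, ‖z‖ = 1 ∧ inner ℝ z h = 0 ∧ q = inner ℝ z (riemHess F h z)}

/-- `h` is a stationary point of `F` on the sphere. -/
def IsStationary (F : Vec n → ℝ) (h : Vec n) : Prop :=
  h ∈ unitSphere n ∧ riemGrad F h = 0

/-- `h` is a local minimum of `F` on the sphere. -/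
def IsSphereLocalMin (F : Vec n → ℝ) (h : Vec n) : Prop :=
  h ∈ unitSphere n ∧ IsLocalMinOn F (unitSphere n) h

/-- `h` is a stationary point of `F` on the sphere at which the Riemannian Hessian has a strictly
negative eigenvalue. -/
def IsStrictSaddle (F : Vec n → ℝ) (h : Vec n) : Prop :=
  IsStationary F h ∧
    ∃ μ : ℝ, μ < 0 ∧ Module.End.HasEigenvalue (riemHess F h : Vec n →ₗ[ℝ] Vec n) μ

end Calculus

section Objective

variable {n : ℕ} [NeZero n]

/-- A matrix acting on `ℝⁿ`. -/
def act (M : Matrix (ZMod n) (ZMod n) ℝ) (h : Vec n) : Vec n :=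
  WithLp.toLp 2 (M.mulVec (fun j => h j))

/-- The circulant matrix `C_x`, whose first column is `x`. -/
def circ (x : Vec n) : Matrix (ZMod n) (ZMod n) ℝ :=
  Matrix.circulant (fun j => x j)

/-- Circular convolution. -/
def circConv (x f : Vec n) : Vec n :=
  WithLp.toLp 2 (fun k => ∑ j, x j * f (k - j))

/-- Circular convolution with `f` is invertible: `f ⊛ g = e` for some filter `g`, where `e` is the
first standard basis vector. -/
def ConvInvertible (f : Vec n) : Prop :=
  ∃ g : Vec n, circConv f g = EuclideanSpace.single 0 1

/-- The ratio of the largest and the smallest magnitude of the discrete Fourier transform of `f`. -/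
def condNumber (f : Vec n) : ℝ :=
  (⨆ j, ‖ZMod.dft (fun i => (f i : ℂ)) j‖) / (⨅ k, ‖ZMod.dft (fun i => (f i : ℂ)) k‖)

/-- Real power of a symmetric matrix, by functional calculus. -/
def matPow (M : Matrix (ZMod n) (ZMod n) ℝ) (s : ℝ) : Matrix (ZMod n) (ZMod n) ℝ :=
  cfc (fun t : ℝ => t ^ s) M

/-- `φ(v) = -‖v‖₄⁴ / 4`. -/
def phi (v : Vec n) : ℝ := -(1 / 4) * ∑ j, (v j) ^ 4

variable {N : ℕ}

/-- `(θ n N)⁻¹ ∑ᵢ C_{yᵢ}ᵀ C_{yᵢ}`. -/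
def gramMatrix (θ : ℝ) (y : Fin N → Vec n) : Matrix (ZMod n) (ZMod n) ℝ :=
  (1 / (θ * n * N)) • ∑ i, (circ (y i)).transpose * circ (y i)

/-- The preconditioner `R = ((θ n N)⁻¹ ∑ᵢ C_{yᵢ}ᵀ C_{yᵢ})^{-1/2}`. -/
def preconditioner (θ : ℝ) (y : Fin N → Vec n) : Matrix (ZMod n) (ZMod n) ℝ :=
  matPow (gramMatrix θ y) (-1 / 2)

/-- The preconditioned objective `L(h) = N⁻¹ ∑ᵢ φ(C_{yᵢ} R h)`. -/
def objective (θ : ℝ) (y : Fin N → Vec n) (h : Vec n) : ℝ :=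
  (1 / (N : ℝ)) * ∑ i, phi (act (circ (y i)) (act (preconditioner θ y) h))

end Objective

section Model

variable {n : ℕ} [NeZero n] {N : ℕ} {Ω : Type*} [MeasurableSpace Ω]

/-- The Bernoulli-Rademacher model: `x_{i(j)} = A_{ij} B_{ij}` with all `A_{ij}`, `B_{ij}` jointly
independent, `A_{ij}` uniform on `{1, -1}` and `B_{ij}` Bernoulli with parameter `θ`. -/
def IsBernoulliRademacher (P : Measure Ω) (θ : ℝ) (x : Fin N → Ω → Vec n) : Prop :=
  ∃ A B : Fin N × ZMod n → Ω → ℝ,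
    (∀ p, Measurable (A p)) ∧ (∀ p, Measurable (B p)) ∧
    iIndepFun (fun k : (Fin N × ZMod n) ⊕ (Fin N × ZMod n) => Sum.elim A B k) P ∧
    (∀ p, P {ω | A p ω = 1} = 1 / 2 ∧ P {ω | A p ω = -1} = 1 / 2) ∧
    (∀ p, P {ω | B p ω = 1} = ENNReal.ofReal θ ∧ P {ω | B p ω = 0} = ENNReal.ofReal (1 - θ)) ∧
    ∀ i j ω, x i ω j = A (i, j) ω * B (i, j) ω

/-- `𝔼 L''(h)`, where `L''(h) = N⁻¹ ∑ᵢ φ(C_{xᵢ} h)`. -/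
def expectedObjective (P : Measure Ω) (x : Fin N → Ω → Vec n) (h : Vec n) : ℝ :=
  ∫ ω, (1 / (N : ℝ)) * ∑ i, phi (act (circ (x i ω)) h) ∂P

/-- The number of nonzero entries of `h`. -/
def numNonzero (h : Vec n) : ℕ := Set.ncard {j | h j ≠ 0}

/-- The points of the sphere in the `(ρ, r)`-neighborhood `‖h^{⊙2} - h₀^{⊙2}‖_∞ ≤ ρ / r` of some
stationary point `h₀` of `𝔼 L''` with `r` nonzero entries. -/
def nearStationary (P : Measure Ω) (x : Fin N → Ω → Vec n) (ρ : ℝ) (r : ℕ) : Set (Vec n) :=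
  {h | h ∈ unitSphere n ∧ ∃ h₀ : Vec n, IsStationary (expectedObjective P x) h₀ ∧
    numNonzero h₀ = r ∧ ∀ j, |(h j) ^ 2 - (h₀ j) ^ 2| ≤ ρ / r}

/-- The matrix `(C_fᵀ C_f)^{1/2} C_f⁻¹`. -/
def rotation (f : Vec n) : Matrix (ZMod n) (ZMod n) ℝ :=
  matPow ((circ f).transpose * circ f) (1 / 2) * (circ f)⁻¹

/-- `ℋ₁`: the rotated neighborhoods of the stationary points with one nonzero entry. -/
def region1 (P : Measure Ω) (x : Fin N → Ω → Vec n) (f : Vec n) (ρ : ℝ) : Set (Vec n) :=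
  act (rotation f) '' nearStationary P x ρ 1

/-- `ℋ₂`: the rotated neighborhoods of the stationary points with more than one nonzero entry. -/
def region2 (P : Measure Ω) (x : Fin N → Ω → Vec n) (f : Vec n) (ρ : ℝ) : Set (Vec n) :=
  act (rotation f) '' {h | ∃ r : ℕ, 1 < r ∧ h ∈ nearStationary P x ρ r}

/-- `ℋ₃`: the rotation of the rest of the sphere. -/
def region3 (P : Measure Ω) (x : Fin N → Ω → Vec n) (f : Vec n) (ρ : ℝ) : Set (Vec n) :=
  act (rotation f) '' (unitSphere n \
    (nearStationary P x ρ 1 ∪ {h | ∃ r : ℕ, 1 < r ∧ h ∈ nearStationary P x ρ r}))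

/-- `c(n, θ, ρ) = θ (1 - 3θ) ρ² / (2n)`. -/
def gap (n : ℕ) (θ ρ : ℝ) : ℝ := θ * (1 - 3 * θ) * ρ ^ 2 / (2 * n)

end Model

end

end MSBD

/-! Put $U=(C_f^\top C_f)^{1/2}C_f^{-1}$, an orthogonal matrix, and $\beta=\theta(1-3\theta)$.
Circulant matrices and their transposes commute, so $M=C_fRU$ equals $D^{-1/2}$, where $D$ is the
Gram matrix of the unobserved $x_i$: the filter cancels exactly. In the rotated variable,
$L(Uu)=-\frac14Q(Mu,Mu,Mu,Mu)$, where $Q$ is the quadrilinear form whose coefficients are the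
empirical fourth moments of the rows of the $C_{x_i}$ (`objective_circConv`,
`circ_mul_preconditioner_mul_rotation`).

The expectation of $Q$ is `popForm`, a multiple of $\beta\sum_j u_j^4$ plus products of inner
products. The latter are constant on the sphere, so the population landscape is that of
$-\|u\|_4^4$. Its stationary points are the vectors whose nonzero entries have equal magnitude. Near
$\pm e_j$ the curvature is at least $n\beta/2$; near the other stationary points some direction has
curvature at most $-\beta$; elsewhere the gradient has norm at least $\beta\rho^2/n=2c$
(`popForm_curvature_of_singleton`, `exists_popForm_curvature_neg`, `exists_popForm_slope`).

For a tangent unit vector $z$, the slope of a quartic is $-Q(h,h,h,z)$ and its curvature is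
$Q(h,h,h,h)-3Q(h,h,z,z)$. Hence a bound $c$ on the difference of the two quadrilinear forms at unit
vectors transfers everything, with loss $c$ in the slope and $4c$ in the curvature; no covering of
the sphere is needed. Hoeffding's inequality and a union bound over the $n^4+n^2$ moments give
entrywise errors of at most $\tau=\beta\rho^2/(64n^3)$. These make the form error at most a constant
times $n^2\tau$ and $\|M-I\|\le2n\tau$, and `objective_near_population` checks that the total is at
most $c$.

Stationary points, local minima and strict saddles are then classified by expanding the quartic
along great circles (`necessary_conditions_of_isSphereLocalMin`,
`isSphereLocalMin_of_curvature_pos`, `isStrictSaddle_of_curvature_neg`). -/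

namespace MSBD

noncomputable section

/-! ### First- and second-order calculus of quartics on the sphere. -/

section QuarticCalculus

variable {n : ℕ} [NeZero n] {ι : Type*} [Fintype ι]

/-- The symmetric quadrilinear form `w ∑ₚ ⟨aₚ, u₁⟩ ⟨aₚ, u₂⟩ ⟨aₚ, u₃⟩ ⟨aₚ, u₄⟩`. -/
def quarticForm (w : ℝ) (a : ι → Vec n) (u₁ u₂ u₃ u₄ : Vec n) : ℝ :=
  w * ∑ p, inner ℝ (a p) u₁ * inner ℝ (a p) u₂ * inner ℝ (a p) u₃ * inner ℝ (a p) u₄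

/-- The quartic function `-(w / 4) ∑ₚ ⟨aₚ, h⟩⁴`. -/
def quartic (w : ℝ) (a : ι → Vec n) (h : Vec n) : ℝ :=
  -(w / 4) * ∑ p, inner ℝ (a p) h ^ 4

theorem quartic_eq_form (w : ℝ) (a : ι → Vec n) (h : Vec n) :
    quartic w a h = -(1 / 4) * quarticForm w a h h h h := by
  simp only [quartic, quarticForm, Finset.mul_sum]
  refine Finset.sum_congr rfl fun p _ => by ring

theorem hasGradientAt_quartic (w : ℝ) (a : ι → Vec n) (h : Vec n) :
    HasGradientAt (quartic w a) (∑ p, (-w * inner ℝ (a p) h ^ 3) • a p) h := by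
  rw [hasGradientAt_iff_hasFDerivAt]
  have h1 : ∀ p, HasFDerivAt (fun v : Vec n => inner ℝ (a p) v ^ 4)
      ((4 * inner ℝ (a p) h ^ 3) • innerSL ℝ (a p)) h := by
    intro p
    have := ((innerSL ℝ (a p)).hasFDerivAt (x := h)).pow 4
    simpa using this
  have h2 := (HasFDerivAt.fun_sum (u := Finset.univ) fun p _ => h1 p).const_mul (-(w / 4))
  refine h2.congr_fderiv ?_
  ext z
  simp [Finset.mul_sum]
  refine Finset.sum_congr rfl fun p _ => by ring

theorem gradient_quartic (w : ℝ) (a : ι → Vec n) :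
    gradient (quartic w a) = fun h => ∑ p, (-w * inner ℝ (a p) h ^ 3) • a p :=
  funext fun h => (hasGradientAt_quartic w a h).gradient

theorem inner_gradient_quartic (w : ℝ) (a : ι → Vec n) (h z : Vec n) :
    inner ℝ (gradient (quartic w a) h) z = -quarticForm w a h h h z := by
  simp only [gradient_quartic, sum_inner, inner_smul_left, quarticForm, Finset.mul_sum,
    ← Finset.sum_neg_distrib]
  refine Finset.sum_congr rfl fun p _ => by simp; ring

theorem fderiv_gradient_quartic (w : ℝ) (a : ι → Vec n) (h z : Vec n) :
    fderiv ℝ (gradient (quartic w a)) h z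
      = ∑ p, (-3 * w * inner ℝ (a p) h ^ 2 * inner ℝ (a p) z) • a p := by
  have h1 : ∀ p, HasFDerivAt (fun v : Vec n => (-w * inner ℝ (a p) v ^ 3) • a p)
      (((-w) • (3 * inner ℝ (a p) h ^ 2) • innerSL ℝ (a p)).smulRight (a p)) h := by
    intro p
    have := ((((innerSL ℝ (a p)).hasFDerivAt (x := h)).pow 3).const_mul (-w)).smul_const (a p)
    simpa using this
  have h2 := HasFDerivAt.fun_sum (u := Finset.univ) fun p _ => h1 p
  rw [gradient_quartic, h2.fderiv]
  simp
  refine Finset.sum_congr rfl fun p _ => ?_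
  congr 1; ring

theorem inner_fderiv_gradient_quartic (w : ℝ) (a : ι → Vec n) (h z y : Vec n) :
    inner ℝ (fderiv ℝ (gradient (quartic w a)) h z) y = -3 * quarticForm w a h h z y := by
  simp only [fderiv_gradient_quartic, sum_inner, inner_smul_left, quarticForm, Finset.mul_sum]
  refine Finset.sum_congr rfl fun p _ => by simp; ring

theorem tangentProj_apply (h z : Vec n) : tangentProj h z = z - inner ℝ h z • h := by
  simp [tangentProj]

theorem tangentProj_of_orthogonal {h z : Vec n} (hz : inner ℝ z h = 0) : tangentProj h z = z := by
  rw [tangentProj_apply, real_inner_comm, hz]; simp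

theorem inner_tangentProj (h y z : Vec n) :
    inner ℝ (tangentProj h y) z = inner ℝ y (tangentProj h z) := by
  simp only [tangentProj_apply, inner_sub_left, inner_sub_right, inner_smul_left, inner_smul_right]
  simp [real_inner_comm]; ring

theorem inner_tangentProj_self {h : Vec n} (hh : ‖h‖ = 1) (y : Vec n) :
    inner ℝ (tangentProj h y) h = 0 := by
  simp [tangentProj_apply, inner_sub_left, inner_smul_left, hh, real_inner_comm]

theorem inner_riemGrad_quartic (w : ℝ) (a : ι → Vec n) {h z : Vec n} (hz : inner ℝ z h = 0) :
    inner ℝ (riemGrad (quartic w a) h) z = -quarticForm w a h h h z := by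
  rw [riemGrad, inner_tangentProj, tangentProj_of_orthogonal hz, inner_gradient_quartic]

theorem inner_riemHess_quartic (w : ℝ) (a : ι → Vec n) (h y z : Vec n) :
    inner ℝ (riemHess (quartic w a) h y) z =
      -3 * quarticForm w a h h (tangentProj h y) (tangentProj h z)
        + quarticForm w a h h h h * inner ℝ (tangentProj h y) z := by
  simp only [riemHess, sub_apply, ContinuousLinearMap.comp_apply,
    smul_apply, inner_sub_left, inner_smul_left, inner_gradient_quartic,
    inner_tangentProj h (fderiv ℝ _ _ _), inner_fderiv_gradient_quartic]
  simp

/-- Linearity of the right-hand side in the quadrilinear form is what makes the landscape stable: an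
error $\varepsilon$ in the form at unit vectors costs at most $4\varepsilon$ in curvature. -/
theorem curvature_quartic (w : ℝ) (a : ι → Vec n) {h z : Vec n} (hz : inner ℝ z h = 0)
    (hz1 : ‖z‖ = 1) :
    inner ℝ z (riemHess (quartic w a) h z) =
      quarticForm w a h h h h - 3 * quarticForm w a h h z z := by
  rw [real_inner_comm, inner_riemHess_quartic, tangentProj_of_orthogonal hz]
  simp [hz1]; ring

theorem quarticForm_swap (w : ℝ) (a : ι → Vec n) (u₁ u₂ u₃ u₄ : Vec n) :
    quarticForm w a u₁ u₂ u₃ u₄ = quarticForm w a u₁ u₂ u₄ u₃ := by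
  simp only [quarticForm]
  congr 1
  refine Finset.sum_congr rfl fun p _ => by ring

theorem riemHess_quartic_isSymmetric (w : ℝ) (a : ι → Vec n) (h : Vec n) :
    (riemHess (quartic w a) h : Vec n →ₗ[ℝ] Vec n).IsSymmetric := by
  intro y z
  simp only [ContinuousLinearMap.coe_coe]
  rw [real_inner_comm _ y, inner_riemHess_quartic, inner_riemHess_quartic, quarticForm_swap,
    inner_tangentProj, real_inner_comm _ y]

/-- A stationary point of negative curvature is a strict saddle. -/
theorem isStrictSaddle_of_curvature_neg (w : ℝ) (a : ι → Vec n) {h : Vec n}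
    (hs : IsStationary (quartic w a) h) {q : ℝ}
    (hq : q ∈ tangentCurvatures (quartic w a) h) (hneg : q < 0) :
    IsStrictSaddle (quartic w a) h := by
  obtain ⟨z, hz1, hz, rfl⟩ := hq
  have hz0 : z ≠ 0 := by rintro rfl; simp at hz1
  have : Nontrivial (Vec n) := ⟨z, 0, hz0⟩
  have hsym := riemHess_quartic_isSymmetric w a h
  refine ⟨hs, _, ?_, hsym.hasEigenvalue_iInf_of_finiteDimensional⟩
  set T := riemHess (quartic w a) h
  -- The least eigenvalue is the infimum of the Rayleigh quotient. Boundedness below is needed to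
  -- compare this infimum with the quotient at `z`, which is negative.
  have hb : BddBelow (Set.range fun x : { x : Vec n // x ≠ 0 } =>
      (RCLike.re (inner ℝ ((T : Vec n →ₗ[ℝ] Vec n) x) (x : Vec n)) / ‖(x : Vec n)‖ ^ 2 : ℝ)) := by
    refine ⟨-‖T‖, ?_⟩
    rintro _ ⟨x, rfl⟩
    have hx : 0 < ‖(x : Vec n)‖ := norm_pos_iff.2 x.2
    simp only [ContinuousLinearMap.coe_coe, RCLike.re_to_real]
    rw [le_div_iff₀ (by positivity)]
    have h1 := abs_real_inner_le_norm (T x) (x : Vec n)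
    have h2 := T.le_opNorm (x : Vec n)
    have h3 := neg_le_of_abs_le h1
    nlinarith
  refine (ciInf_le hb ⟨z, hz0⟩).trans_lt ?_
  simp only [ContinuousLinearMap.coe_coe, RCLike.re_to_real, hz1]
  rw [real_inner_comm]
  simpa using hneg

theorem quarticForm_le (w : ℝ) (a : ι → Vec n) (u₁ u₂ u₃ u₄ : Vec n) :
    |quarticForm w a u₁ u₂ u₃ u₄| ≤
      (|w| * ∑ p, ‖a p‖ ^ 4) * (‖u₁‖ * ‖u₂‖ * ‖u₃‖ * ‖u₄‖) := by
  rw [quarticForm, abs_mul, mul_assoc]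
  refine mul_le_mul_of_nonneg_left ?_ (abs_nonneg _)
  rw [Finset.sum_mul]
  refine (Finset.abs_sum_le_sum_abs _ _).trans (Finset.sum_le_sum fun p _ => ?_)
  simp only [abs_mul]
  calc _ ≤ (‖a p‖ * ‖u₁‖) * (‖a p‖ * ‖u₂‖) * (‖a p‖ * ‖u₃‖) * (‖a p‖ * ‖u₄‖) := by
        gcongr <;> exact abs_real_inner_le_norm _ _
    _ = _ := by ring

theorem quarticForm_smul (w : ℝ) (a : ι → Vec n) (c : ℝ) (u : Vec n) :
    quarticForm w a (c • u) (c • u) (c • u) (c • u) = c ^ 4 * quarticForm w a u u u u := by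
  simp only [quarticForm, inner_smul_right, Finset.mul_sum]
  refine Finset.sum_congr rfl fun p _ => by ring

theorem quarticForm_add_smul (w : ℝ) (a : ι → Vec n) (t : ℝ) (h z : Vec n) :
    quarticForm w a (h + t • z) (h + t • z) (h + t • z) (h + t • z) =
      quarticForm w a h h h h + 4 * t * quarticForm w a h h h z
        + 6 * t ^ 2 * quarticForm w a h h z z + 4 * t ^ 3 * quarticForm w a h z z z
        + t ^ 4 * quarticForm w a z z z z := by
  simp only [quarticForm, inner_smul_right, inner_add_right, Finset.mul_sum,
    ← Finset.sum_add_distrib]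
  refine Finset.sum_congr rfl fun p _ => by ring

/-- Along the great circle through `h` in the direction `z`, after normalization. -/
theorem quartic_normalized (w : ℝ) (a : ι → Vec n) (t : ℝ) (h z : Vec n) :
    quartic w a ((√(1 + t ^ 2))⁻¹ • (h + t • z)) - quartic w a h =
      (1 + t ^ 2)⁻¹ ^ 2 * (-t * quarticForm w a h h h z
        + t ^ 2 / 2 * (quarticForm w a h h h h - 3 * quarticForm w a h h z z)
        - t ^ 3 * quarticForm w a h z z z
        + t ^ 4 / 4 * (quarticForm w a h h h h - quarticForm w a z z z z)) := by
  have h1 : (√(1 + t ^ 2))⁻¹ ^ 4 = (1 + t ^ 2)⁻¹ ^ 2 := by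
    rw [show 4 = 2 * 2 by norm_num, pow_mul, inv_pow, Real.sq_sqrt (by positivity)]
  rw [quartic_eq_form, quartic_eq_form, quarticForm_smul, quarticForm_add_smul, h1]
  have : (1 + t ^ 2) ≠ 0 := by positivity
  field_simp
  ring

theorem norm_normalized {h z : Vec n} (hh : ‖h‖ = 1) (hz1 : ‖z‖ = 1) (hz : inner ℝ z h = 0)
    (t : ℝ) : ‖(√(1 + t ^ 2))⁻¹ • (h + t • z)‖ = 1 := by
  have h1 : ‖h + t • z‖ = √(1 + t ^ 2) := by
    rw [eq_comm, Real.sqrt_eq_iff_mul_self_eq (by positivity) (norm_nonneg _),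
      ← real_inner_self_eq_norm_mul_norm]
    simp only [inner_add_left, inner_add_right, inner_smul_left, inner_smul_right, hz,
      real_inner_comm z h, real_inner_self_eq_norm_sq, hh, hz1]
    simp; ring
  rw [norm_smul, h1, norm_inv, Real.norm_of_nonneg (Real.sqrt_nonneg _)]
  exact inv_mul_cancel₀ (Real.sqrt_ne_zero'.2 (by positivity))

/-- Division by $t$ and one-sided limits at $0$ give both signs for `l₁`; once `l₁` vanishes,
division by $t^2$ gives the sign of `l₂`. -/
theorem coeffs_of_eventually_nonneg {l₁ l₂ l₃ l₄ : ℝ}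
    (h : ∀ᶠ t : ℝ in nhds 0, 0 ≤ l₁ * t + l₂ * t ^ 2 + l₃ * t ^ 3 + l₄ * t ^ 4) :
    l₁ = 0 ∧ 0 ≤ l₂ := by
  have hlim : ∀ b₀ b₁ b₂ b₃ : ℝ, Filter.Tendsto
      (fun t : ℝ => b₀ + b₁ * t + b₂ * t ^ 2 + b₃ * t ^ 3) (nhdsWithin 0 {0}ᶜ) (nhds b₀) := by
    intro b₀ b₁ b₂ b₃
    have hc : Continuous (fun t : ℝ => b₀ + b₁ * t + b₂ * t ^ 2 + b₃ * t ^ 3) := by fun_prop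
    have := hc.tendsto 0
    simp only [mul_zero, add_zero, ne_eq, OfNat.ofNat_ne_zero, not_false_eq_true, zero_pow] at this
    exact this.mono_left nhdsWithin_le_nhds
  have h1 : l₁ = 0 := by
    refine le_antisymm ?_ ?_
    · refine le_of_tendsto ((hlim l₁ l₂ l₃ l₄).mono_left
        (nhdsWithin_mono 0 (s := Set.Iio 0) fun x hx => ne_of_lt hx)) ?_
      filter_upwards [nhdsWithin_le_nhds h, self_mem_nhdsWithin] with t ht ht0
      have ht0 : t < 0 := ht0
      by_contra! hlt
      nlinarith [mul_neg_of_pos_of_neg hlt ht0]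
    · refine ge_of_tendsto ((hlim l₁ l₂ l₃ l₄).mono_left
        (nhdsWithin_mono 0 (s := Set.Ioi 0) fun x hx => ne_of_gt hx)) ?_
      filter_upwards [nhdsWithin_le_nhds h, self_mem_nhdsWithin] with t ht ht0
      have ht0 : 0 < t := ht0
      by_contra! hlt
      nlinarith [mul_neg_of_neg_of_pos hlt ht0]
  refine ⟨h1, ge_of_tendsto (hlim l₂ l₃ l₄ 0) ?_⟩
  filter_upwards [nhdsWithin_le_nhds h, self_mem_nhdsWithin] with t ht ht0
  have ht0 : 0 < t ^ 2 := by
    have : t ≠ 0 := ht0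
    positivity
  rw [h1] at ht
  by_contra! hlt
  nlinarith [mul_neg_of_neg_of_pos hlt ht0]

/-- First and second order necessary conditions for a local minimum on the sphere. -/
theorem necessary_conditions_of_isSphereLocalMin (w : ℝ) (a : ι → Vec n) {h : Vec n}
    (hm : IsSphereLocalMin (quartic w a) h) {z : Vec n} (hz1 : ‖z‖ = 1) (hz : inner ℝ z h = 0) :
    quarticForm w a h h h z = 0 ∧
      0 ≤ inner ℝ z (riemHess (quartic w a) h z) := by
  obtain ⟨hh, hm⟩ := hm
  have hh : ‖h‖ = 1 := hh
  have hcont : Filter.Tendsto (fun t : ℝ => (√(1 + t ^ 2))⁻¹ • (h + t • z)) (nhds 0)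
      (nhdsWithin h (unitSphere n)) := by
    refine tendsto_nhdsWithin_iff.2 ⟨?_, Filter.Eventually.of_forall fun t =>
      norm_normalized hh hz1 hz t⟩
    have hc : Continuous (fun t : ℝ => (√(1 + t ^ 2))⁻¹ • (h + t • z)) := by
      have h0 : Continuous (fun t : ℝ => √(1 + t ^ 2)) := by fun_prop
      have h1 : Continuous (fun t : ℝ => h + t • z) := by fun_prop
      exact (h0.inv₀ fun t => Real.sqrt_ne_zero'.2 (by positivity)).smul h1
    have := hc.tendsto 0
    simpa using this
  have hev := hcont.eventually hm
  have := coeffs_of_eventually_nonneg (l₁ := -quarticForm w a h h h z)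
    (l₂ := (quarticForm w a h h h h - 3 * quarticForm w a h h z z) / 2)
    (l₃ := -quarticForm w a h z z z)
    (l₄ := (quarticForm w a h h h h - quarticForm w a z z z z) / 4) (by
      filter_upwards [hev] with t ht
      have h1 := quartic_normalized w a t h z
      have h2 := sub_nonneg.2 ht
      rw [h1] at h2
      have h3 := nonneg_of_mul_nonneg_right h2 (by positivity)
      linarith)
  refine ⟨by linarith [this.1], ?_⟩
  rw [curvature_quartic w a hz hz1]
  linarith [this.2]

/-- A nonzero Riemannian gradient, normalized, would itself be a tangent direction of nonzero slope.
-/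
theorem isStationary_of_isSphereLocalMin (w : ℝ) (a : ι → Vec n) {h : Vec n}
    (hm : IsSphereLocalMin (quartic w a) h) : IsStationary (quartic w a) h := by
  refine ⟨hm.1, ?_⟩
  by_contra hne
  set g := riemGrad (quartic w a) h with hg
  have hgn : 0 < ‖g‖ := norm_pos_iff.2 hne
  have hgh : inner ℝ g h = 0 := inner_tangentProj_self hm.1 _
  have hz : inner ℝ (‖g‖⁻¹ • g) h = 0 := by rw [inner_smul_left, hgh, mul_zero]
  have h1 := (necessary_conditions_of_isSphereLocalMin w a hm (norm_smul_inv_norm hne) hz).1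
  have h2 := inner_riemGrad_quartic w a hz
  simp only [RCLike.ofReal_real_eq_id, id] at h1
  rw [h1, ← hg, inner_smul_right, real_inner_self_eq_norm_sq] at h2
  have : ‖g‖⁻¹ * ‖g‖ ^ 2 = ‖g‖ := by field_simp
  linarith

/-- The quadratic term absorbs the rest: for $t\le1$ the cubic and quartic terms cost at most
$\frac32Kt^3\le\frac38ct^2$, below the available $\frac12ct^2$. The shape of the conclusion is the
bracket of `quartic_normalized` at zero slope. -/
theorem quartic_expansion_nonneg {K t c B2 X3 X4 : ℝ} (hK0 : 0 ≤ K) (ht0 : 0 ≤ t)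
    (ht : t < min 1 (c / (4 * (K + 1)))) (h3 : X3 ≤ K) (h4 : -(2 * K) ≤ X4) (hB : c ≤ B2) :
    0 ≤ -t * 0 + t ^ 2 / 2 * B2 - t ^ 3 * X3 + t ^ 4 / 4 * X4 := by
  have ht1 : t ≤ 1 := ht.le.trans (min_le_left _ _)
  have ht2 : t * (4 * (K + 1)) ≤ c := by
    rw [← le_div_iff₀ (by linarith)]; exact ht.le.trans (min_le_right _ _)
  have h5 : t ^ 2 * K ≤ t * K := by nlinarith [mul_nonneg ht0 hK0]
  have h6 : 0 ≤ t ^ 2 * (c / 2 - t * K - t ^ 2 / 4 * (2 * K)) :=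
    mul_nonneg (sq_nonneg t) (by nlinarith)
  have e3 : t ^ 2 / 2 * c ≤ t ^ 2 / 2 * B2 := by gcongr
  have e4 : t ^ 3 * X3 ≤ t ^ 3 * K := by gcongr
  have e5 : t ^ 4 / 4 * (-(2 * K)) ≤ t ^ 4 / 4 * X4 := by gcongr
  nlinarith

/-- A stationary point of positive curvature is a local minimum on the sphere. -/
theorem isSphereLocalMin_of_curvature_pos (w : ℝ) (a : ι → Vec n) {h : Vec n}
    (hs : IsStationary (quartic w a) h) {c : ℝ} (hc : 0 < c)
    (hcurv : ∀ z, ‖z‖ = 1 → inner ℝ z h = 0 → c ≤ inner ℝ z (riemHess (quartic w a) h z)) :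
    IsSphereLocalMin (quartic w a) h := by
  obtain ⟨hh, hg⟩ := hs
  have hh : ‖h‖ = 1 := hh
  refine ⟨hh, ?_⟩
  obtain ⟨K, hK⟩ : ∃ K, K = |w| * ∑ p, ‖a p‖ ^ 4 := ⟨_, rfl⟩
  have hK0 : 0 ≤ K :=
    hK ▸ mul_nonneg (abs_nonneg _) (Finset.sum_nonneg fun p _ => pow_nonneg (norm_nonneg _) _)
  have hin : Filter.Tendsto (fun h' : Vec n => inner ℝ h h') (nhds h) (nhds 1) := by
    have hct : Continuous (fun h' : Vec n => inner ℝ h h') := by fun_prop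
    have := hct.tendsto h
    rwa [real_inner_self_eq_norm_sq, hh, one_pow] at this
  have hpr : Filter.Tendsto (fun h' : Vec n => (inner ℝ h h')⁻¹ • tangentProj h h') (nhds h)
      (nhds 0) := by
    have h1 := (tangentProj h).continuous.tendsto h
    have h2 := (hin.inv₀ one_ne_zero).smul h1
    rwa [tangentProj_apply h h, real_inner_self_eq_norm_sq, hh, one_pow, one_smul, sub_self,
      smul_zero] at h2
  -- Since `K` bounds the form on all unit vectors, this radius serves every tangent direction at
  -- once.
  have hδ : 0 < min 1 (c / (4 * (K + 1))) := by positivity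
  have e1 := hin.eventually (lt_mem_nhds one_pos)
  have e2 := hpr.norm.eventually (gt_mem_nhds (by rwa [norm_zero]))
  refine (Filter.Eventually.filter_mono nhdsWithin_le_nhds (e1.and e2)).mp ?_
  filter_upwards [self_mem_nhdsWithin] with h' hh' ⟨hpos, hsmall'⟩
  have hh' : ‖h'‖ = 1 := hh'
  set s := inner ℝ h h' with hs
  -- Central projection to the tangent space: each point of the sphere near `h` is a normalized `h +
  -- y` with `y` tangent and small, so it lies on one of the expanded great circles.
  set y := s⁻¹ • tangentProj h h' with hy
  have hyh : inner ℝ y h = 0 := by rw [hy, inner_smul_left, inner_tangentProj_self hh, mul_zero]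
  have hsy : h' = s • (h + y) := by
    rw [hy, smul_add, smul_inv_smul₀ hpos.ne', tangentProj_apply]; simp [hs]
  by_cases hy0 : y = 0
  · rw [hy0, add_zero] at hsy
    have : s = 1 := by
      have := congrArg norm hsy
      rw [norm_smul, hh, hh', mul_one, Real.norm_of_nonneg hpos.le] at this
      exact this.symm
    rw [this, one_smul] at hsy
    rw [hsy]
  set t := ‖y‖ with ht
  have ht0 : 0 < t := norm_pos_iff.2 hy0
  set z := t⁻¹ • y with hz
  have hz1 : ‖z‖ = 1 := by rw [hz, norm_smul, norm_inv, norm_norm]; exact inv_mul_cancel₀ ht0.ne'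
  have hzh : inner ℝ z h = 0 := by rw [hz, inner_smul_left, hyh, mul_zero]
  have hytz : y = t • z := by rw [hz, smul_inv_smul₀ ht0.ne']
  have hnorm := norm_normalized hh hz1 hzh t
  rw [← hytz, norm_smul] at hnorm
  have hseq : s = (√(1 + t ^ 2))⁻¹ := by
    have h1 := congrArg norm hsy
    rw [hh', norm_smul, Real.norm_of_nonneg hpos.le] at h1
    rw [norm_inv, Real.norm_of_nonneg (Real.sqrt_nonneg _)] at hnorm
    have h3 : ‖h + y‖ ≠ 0 := by intro h0; rw [h0] at h1; simp at h1
    exact mul_right_cancel₀ h3 (h1.symm.trans hnorm.symm)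
  rw [hseq, hytz] at hsy
  rw [← sub_nonneg, hsy, quartic_normalized]
  refine mul_nonneg (by positivity) ?_
  have hB1 : quarticForm w a h h h z = 0 := by
    have := inner_riemGrad_quartic w a hzh
    rw [hg, inner_zero_left] at this
    linarith
  have hB2 := hcurv z hz1 hzh
  rw [curvature_quartic w a hzh hz1] at hB2
  have hb3 := quarticForm_le w a h z z z
  have hb4 := quarticForm_le w a h h h h
  have hb5 := quarticForm_le w a z z z z
  simp only [hh, hz1, mul_one, ← hK] at hb3 hb4 hb5
  have hb3 := (abs_le.1 hb3).2
  have hb4 := (abs_le.1 hb4).1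
  have hb5 := (abs_le.1 hb5).2
  rw [hB1]
  refine quartic_expansion_nonneg hK0 ht0.le hsmall' hb3 ?_ hB2
  linarith

/-- The least curvature over unit tangent vectors is attained. -/
theorem exists_isLeast_tangentCurvatures (w : ℝ) (a : ι → Vec n) (h : Vec n)
    (hne : ∃ z : Vec n, ‖z‖ = 1 ∧ inner ℝ z h = 0) :
    ∃ m, IsLeast (tangentCurvatures (quartic w a) h) m := by
  set S : Set (Vec n) := Metric.sphere 0 1 ∩ {z | inner ℝ z h = 0} with hS
  have hSc : IsCompact S := by
    refine (isCompact_sphere _ _).inter_right ?_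
    exact isClosed_eq (by fun_prop) continuous_const
  have him : tangentCurvatures (quartic w a) h =
      (fun z => inner ℝ z (riemHess (quartic w a) h z)) '' S := by
    ext q
    simp only [tangentCurvatures, hS, Set.mem_ofPred_eq, Set.mem_image, Set.mem_inter_iff,
      mem_sphere_zero_iff_norm]
    constructor
    · rintro ⟨z, h1, h2, rfl⟩; exact ⟨z, ⟨h1, h2⟩, rfl⟩
    · rintro ⟨z, ⟨h1, h2⟩, rfl⟩; exact ⟨z, h1, h2, rfl⟩
  rw [him]
  obtain ⟨z, h1, h2⟩ := hne
  have hct : Continuous (fun z => inner ℝ z (riemHess (quartic w a) h z)) := by fun_prop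
  exact (hSc.image hct).exists_isLeast ⟨_, z, ⟨by simpa using h1, h2⟩, rfl⟩

end QuarticCalculus
-- The population objective and its stationary points.
section Population

variable {n : ℕ} [NeZero n]

/-- The quadrilinear form of the population objective: the expectation of
`∑ₖ ∏ₗ (C_x uₗ)ₖ` for a Bernoulli-Rademacher vector `x`. -/
def popForm (θ : ℝ) (u₁ u₂ u₃ u₄ : Vec n) : ℝ :=
  n * (θ * (1 - 3 * θ) * ∑ j, u₁ j * u₂ j * u₃ j * u₄ j
    + θ ^ 2 * (inner ℝ u₁ u₂ * inner ℝ u₃ u₄ + inner ℝ u₁ u₃ * inner ℝ u₂ u₄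
      + inner ℝ u₁ u₄ * inner ℝ u₂ u₃))

theorem inner_eq_sum (u v : Vec n) : inner ℝ u v = ∑ j, u j * v j := by
  simp [PiLp.inner_apply, mul_comm]

theorem norm_sq_eq_sum (u : Vec n) : ‖u‖ ^ 2 = ∑ j, u j ^ 2 := by
  rw [EuclideanSpace.real_norm_sq_eq]

theorem abs_coord_le_norm (u : Vec n) (j : ZMod n) : |u j| ≤ ‖u‖ := by
  simpa using PiLp.norm_apply_le u j

theorem sum_abs_mul_le (u v : Vec n) : ∑ j, |u j| * |v j| ≤ ‖u‖ * ‖v‖ := by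
  have h := Real.sum_mul_le_sqrt_mul_sqrt Finset.univ (fun j => |u j|) (fun j => |v j|)
  simpa [EuclideanSpace.norm_eq] using h

/-- Each of the four terms is at most the product of the norms, and the nonnegative weights add up
to $\theta(1-3\theta)+3\theta^2=\theta$. -/
theorem abs_popForm_le {θ : ℝ} (h0 : 0 ≤ θ) (h3 : θ ≤ 1 / 3) (u₁ u₂ u₃ u₄ : Vec n) :
    |popForm θ u₁ u₂ u₃ u₄| ≤ n * θ * (‖u₁‖ * ‖u₂‖ * ‖u₃‖ * ‖u₄‖) := by
  set X := ‖u₁‖ * ‖u₂‖ * ‖u₃‖ * ‖u₄‖ with hX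
  have hs : |∑ j, u₁ j * u₂ j * u₃ j * u₄ j| ≤ X := by
    calc |∑ j, u₁ j * u₂ j * u₃ j * u₄ j| ≤ ∑ j, (|u₁ j| * |u₂ j|) * (‖u₃‖ * ‖u₄‖) := by
          refine (Finset.abs_sum_le_sum_abs _ _).trans (Finset.sum_le_sum fun j _ => ?_)
          rw [abs_mul, abs_mul, abs_mul, mul_assoc]
          gcongr <;> exact abs_coord_le_norm _ _
      _ ≤ (‖u₁‖ * ‖u₂‖) * (‖u₃‖ * ‖u₄‖) := by
          rw [← Finset.sum_mul]
          gcongr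
          exact sum_abs_mul_le _ _
      _ = X := by rw [hX]; ring
  have hi : ∀ a b c d : Vec n, ‖a‖ * ‖b‖ * ‖c‖ * ‖d‖ = X →
      |inner ℝ a b * inner ℝ c d| ≤ X := by
    intro a b c d h
    rw [abs_mul, ← h, mul_assoc (‖a‖ * ‖b‖)]
    gcongr <;> exact abs_real_inner_le_norm _ _
  have h1 := hi u₁ u₂ u₃ u₄ rfl
  have h2 := hi u₁ u₃ u₂ u₄ (by rw [hX]; ring)
  have h4 := hi u₁ u₄ u₂ u₃ (by rw [hX]; ring)
  have h13 : 0 ≤ 1 - 3 * θ := by linarith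
  rw [popForm, abs_mul, Nat.abs_cast, mul_assoc (n : ℝ) θ]
  refine mul_le_mul_of_nonneg_left ?_ (Nat.cast_nonneg n)
  refine (abs_add_le _ _).trans ?_
  rw [abs_mul (_ * _), abs_mul (θ ^ 2), abs_of_nonneg (mul_nonneg h0 h13), abs_of_nonneg (sq_nonneg θ)]
  have h5 := (abs_add_three (inner ℝ u₁ u₂ * inner ℝ u₃ u₄) (inner ℝ u₁ u₃ * inner ℝ u₂ u₄)
    (inner ℝ u₁ u₄ * inner ℝ u₂ u₃)).trans (add_le_add (add_le_add h1 h2) h4)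
  calc _ ≤ θ * (1 - 3 * θ) * X + θ ^ 2 * (X + X + X) := by
        gcongr
    _ = θ * X := by ring

theorem popForm_sub_left (θ : ℝ) (u v u₂ u₃ u₄ : Vec n) :
    popForm θ (u - v) u₂ u₃ u₄ = popForm θ u u₂ u₃ u₄ - popForm θ v u₂ u₃ u₄ := by
  simp only [popForm, inner_sub_left, PiLp.sub_apply, sub_mul, Finset.sum_sub_distrib]
  ring

/-- Cyclic symmetry lets an estimate in the first slot be used in every slot. -/
theorem popForm_rotate (θ : ℝ) (u₁ u₂ u₃ u₄ : Vec n) :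
    popForm θ u₁ u₂ u₃ u₄ = popForm θ u₂ u₃ u₄ u₁ := by
  simp only [popForm, real_inner_comm _ u₁]
  congr 1
  have : ∑ j, u₁ j * u₂ j * u₃ j * u₄ j = ∑ j, u₂ j * u₃ j * u₄ j * u₁ j :=
    Finset.sum_congr rfl fun j _ => by ring
  rw [this]
  ring

/-- Stability of the population form under a linear map close to the identity. -/
theorem abs_popForm_map_sub_le {θ ε : ℝ} (h0 : 0 ≤ θ) (h3 : θ ≤ 1 / 3) (hε0 : 0 ≤ ε) (hε1 : ε ≤ 1)
    {M : Vec n → Vec n} (hM : ∀ u, ‖M u - u‖ ≤ ε * ‖u‖) (u₁ u₂ u₃ u₄ : Vec n) :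
    |popForm θ (M u₁) (M u₂) (M u₃) (M u₄) - popForm θ u₁ u₂ u₃ u₄| ≤
      15 * (n * θ) * ε * (‖u₁‖ * ‖u₂‖ * ‖u₃‖ * ‖u₄‖) := by
  have hM2 : ∀ u, ‖M u‖ ≤ 2 * ‖u‖ := by
    intro u
    have h1 := norm_le_norm_sub_add (M u) u
    have h2 := hM u
    nlinarith [norm_nonneg u]
  have key : ∀ a b c d : Vec n, |popForm θ (M a) b c d - popForm θ a b c d| ≤
      n * θ * ε * (‖a‖ * ‖b‖ * ‖c‖ * ‖d‖) := by
    intro a b c d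
    rw [← popForm_sub_left]
    refine (abs_popForm_le h0 h3 _ _ _ _).trans ?_
    calc n * θ * (‖M a - a‖ * ‖b‖ * ‖c‖ * ‖d‖) ≤ n * θ * ((ε * ‖a‖) * ‖b‖ * ‖c‖ * ‖d‖) := by
          gcongr; exact hM a
      _ = _ := by ring
  -- The arguments are replaced one at a time. Each one already replaced has at most twice its norm,
  -- whence the constant $15=1+2+4+8$.
  have e1 := key u₁ u₂ u₃ u₄
  have e2 := key u₂ u₃ u₄ (M u₁)
  have e3 := key u₃ u₄ (M u₁) (M u₂)
  have e4 := key u₄ (M u₁) (M u₂) (M u₃)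
  rw [popForm_rotate θ (M u₂), popForm_rotate θ u₃, popForm_rotate θ u₄,
    popForm_rotate θ u₂, popForm_rotate θ u₃, popForm_rotate θ u₄] at e2
  rw [popForm_rotate θ (M u₃), popForm_rotate θ u₄,
    popForm_rotate θ u₃, popForm_rotate θ u₄] at e3
  rw [popForm_rotate θ (M u₄), popForm_rotate θ u₄] at e4
  have b2 : ‖u₂‖ * ‖u₃‖ * ‖u₄‖ * ‖M u₁‖ ≤ 2 * (‖u₁‖ * ‖u₂‖ * ‖u₃‖ * ‖u₄‖) := by
    calc _ ≤ ‖u₂‖ * ‖u₃‖ * ‖u₄‖ * (2 * ‖u₁‖) := by gcongr; exact hM2 _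
      _ = _ := by ring
  have b3 : ‖u₃‖ * ‖u₄‖ * ‖M u₁‖ * ‖M u₂‖ ≤ 4 * (‖u₁‖ * ‖u₂‖ * ‖u₃‖ * ‖u₄‖) := by
    calc _ ≤ ‖u₃‖ * ‖u₄‖ * (2 * ‖u₁‖) * (2 * ‖u₂‖) := by gcongr <;> exact hM2 _
      _ = _ := by ring
  have b4 : ‖u₄‖ * ‖M u₁‖ * ‖M u₂‖ * ‖M u₃‖ ≤ 8 * (‖u₁‖ * ‖u₂‖ * ‖u₃‖ * ‖u₄‖) := by
    calc _ ≤ ‖u₄‖ * (2 * ‖u₁‖) * (2 * ‖u₂‖) * (2 * ‖u₃‖) := by gcongr <;> exact hM2 _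
      _ = _ := by ring
  set X := ‖u₁‖ * ‖u₂‖ * ‖u₃‖ * ‖u₄‖
  have hc : (0 : ℝ) ≤ n * θ * ε := by positivity
  have f2 := e2.trans (mul_le_mul_of_nonneg_left b2 hc)
  have f3 := e3.trans (mul_le_mul_of_nonneg_left b3 hc)
  have f4 := e4.trans (mul_le_mul_of_nonneg_left b4 hc)
  rw [abs_le] at *
  constructor <;> linarith

/-- The population objective. -/
def popObjective (θ : ℝ) (h : Vec n) : ℝ :=
  -(1 / 4) * popForm θ h h h h

theorem popObjective_eq (θ : ℝ) : (popObjective θ : Vec n → ℝ) = fun h =>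
    -(n / 4) * (θ * (1 - 3 * θ) * ∑ j, h j ^ 4 + 3 * θ ^ 2 * (‖h‖ ^ 2) ^ 2) := by
  funext h
  have : ∑ j, h j * h j * h j * h j = ∑ j, h j ^ 4 := Finset.sum_congr rfl fun j _ => by ring
  rw [popObjective, popForm, this, real_inner_self_eq_norm_sq]
  ring

theorem hasGradientAt_popObjective (θ : ℝ) (h : Vec n) :
    HasGradientAt (popObjective θ) (WithLp.toLp 2 fun j =>
      -n * (θ * (1 - 3 * θ) * h j ^ 3 + 3 * θ ^ 2 * ‖h‖ ^ 2 * h j)) h := by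
  rw [hasGradientAt_iff_hasFDerivAt, popObjective_eq]
  have h1 : ∀ j, HasFDerivAt (fun v : Vec n => v j ^ 4)
      ((4 * h j ^ 3) • (EuclideanSpace.proj j : Vec n →L[ℝ] ℝ)) h := by
    intro j
    have := ((EuclideanSpace.proj j : Vec n →L[ℝ] ℝ).hasFDerivAt (x := h)).pow 4
    simpa using this
  have h2 := HasFDerivAt.fun_sum (u := Finset.univ) fun j _ => h1 j
  have h3 : HasFDerivAt (fun v : Vec n => (‖v‖ ^ 2) ^ 2)
      ((2 * ‖h‖ ^ 2) • (2 • innerSL ℝ h)) h := by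
    have := ((hasStrictFDerivAt_norm_sq h).hasFDerivAt).pow 2
    simpa using this
  have h4 := ((h2.const_mul (θ * (1 - 3 * θ))).add (h3.const_mul (3 * θ ^ 2))).const_mul
    (-(n / 4 : ℝ))
  refine h4.congr_fderiv ?_
  ext z
  simp [inner_eq_sum, Finset.mul_sum, ← Finset.sum_add_distrib, ← Finset.sum_neg_distrib]
  refine Finset.sum_congr rfl fun j _ => by ring

/-- The $\theta^2$ part depends on `h` through its norm alone, so its gradient is radial and is
removed by the projection. -/
theorem riemGrad_popObjective (θ : ℝ) {h : Vec n} (hh : ‖h‖ = 1) (j : ZMod n) :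
    riemGrad (popObjective θ) h j =
      -(n * (θ * (1 - 3 * θ))) * (h j ^ 3 - (∑ i, h i ^ 4) * h j) := by
  have hs := norm_sq_eq_sum h
  rw [hh] at hs
  rw [riemGrad, (hasGradientAt_popObjective θ h).gradient, tangentProj_apply, inner_eq_sum]
  have : ∑ i, h i * (-n * (θ * (1 - 3 * θ) * h i ^ 3 + 3 * θ ^ 2 * 1 ^ 2 * h i)) =
      -n * (θ * (1 - 3 * θ)) * ∑ i, h i ^ 4 + -n * (3 * θ ^ 2) * ∑ i, h i ^ 2 := by
    rw [Finset.mul_sum, Finset.mul_sum, ← Finset.sum_add_distrib]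
    refine Finset.sum_congr rfl fun i _ => by ring
  simp only [PiLp.sub_apply, PiLp.smul_apply, smul_eq_mul, hh]
  rw [this, ← hs]
  ring

theorem isStationary_popObjective_iff {θ : ℝ} (hβ : 0 < θ * (1 - 3 * θ)) (h : Vec n) :
    IsStationary (popObjective θ) h ↔ ‖h‖ = 1 ∧ ∀ j, h j ^ 3 = (∑ i, h i ^ 4) * h j := by
  refine and_congr_right fun hh => ?_
  have hh : ‖h‖ = 1 := hh
  have hn : (n : ℝ) ≠ 0 := Nat.cast_ne_zero.2 (NeZero.ne n)
  constructor
  · intro h0 j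
    have h1 := riemGrad_popObjective θ hh j
    rw [h0] at h1
    have h2 := (mul_eq_zero.1 h1.symm).resolve_left (by simp [hn, hβ.ne'])
    linarith
  · intro h0
    ext j
    rw [riemGrad_popObjective θ hh j, h0 j]
    simp

/-- The squares of the nonzero entries of a stationary point are equal. -/
theorem sq_eq_inv_numNonzero {θ : ℝ} (hβ : 0 < θ * (1 - 3 * θ)) {h : Vec n}
    (hs : IsStationary (popObjective θ) h) {j : ZMod n} (hj : h j ≠ 0) :
    h j ^ 2 = 1 / numNonzero h := by
  classical
  obtain ⟨hh, h3⟩ := (isStationary_popObjective_iff hβ h).1 hs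
  set m := ∑ i, h i ^ 4
  have hm : ∀ i, h i ≠ 0 → h i ^ 2 = m := fun i hi => by
    have := h3 i
    exact mul_right_cancel₀ hi (by linarith)
  have hsum := norm_sq_eq_sum h
  rw [hh, ← Finset.sum_filter_add_sum_filter_not Finset.univ (fun i => h i ≠ 0),
    Finset.sum_congr rfl (fun i hi => hm i (Finset.mem_filter.1 hi).2), Finset.sum_const,
    Finset.sum_eq_zero (fun i hi => by simpa using (Finset.mem_filter.1 hi).2)] at hsum
  have hc : numNonzero h = (Finset.univ.filter fun i => h i ≠ 0).card := by
    rw [numNonzero, ← Set.ncard_coe_finset]; simp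
  rw [hm j hj, hc, eq_div_iff]
  · simp at hsum ⊢; linarith
  · intro h0; rw [nsmul_eq_mul, h0] at hsum; simp at hsum

theorem numNonzero_pos {h : Vec n} (hh : ‖h‖ = 1) : 0 < numNonzero h := by
  rw [numNonzero, Set.ncard_pos]
  by_contra hne
  rw [Set.not_nonempty_iff_eq_empty, Set.eq_empty_iff_forall_notMem] at hne
  have : h = 0 := by ext j; simpa using hne j
  simp [this] at hh

/-- The vector with entries `1 / √|S|` on `S`. -/
def flatVec (S : Finset (ZMod n)) : Vec n :=
  WithLp.toLp 2 fun j => if j ∈ S then (√(S.card : ℝ))⁻¹ else 0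

theorem flatVec_sq (S : Finset (ZMod n)) (j : ZMod n) :
    flatVec S j ^ 2 = if j ∈ S then 1 / (S.card : ℝ) else 0 := by
  simp only [flatVec]
  split_ifs <;> simp

theorem isStationary_flatVec {θ : ℝ} (hβ : 0 < θ * (1 - 3 * θ)) {S : Finset (ZMod n)}
    (hS : S.Nonempty) : IsStationary (popObjective θ) (flatVec S) := by
  have hc : (S.card : ℝ) ≠ 0 := by exact_mod_cast hS.card_pos.ne'
  rw [isStationary_popObjective_iff hβ]
  constructor
  · rw [← sq_eq_sq₀ (norm_nonneg _) zero_le_one, norm_sq_eq_sum]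
    simp only [flatVec_sq]
    simp [hc]
  · intro j
    have h4 : ∀ i, flatVec S i ^ 4 = if i ∈ S then 1 / (S.card : ℝ) ^ 2 else 0 := by
      intro i
      rw [show 4 = 2 * 2 by norm_num, pow_mul, flatVec_sq]
      split_ifs <;> simp
    simp only [h4]
    rw [pow_succ, flatVec_sq]
    by_cases hj : j ∈ S
    · simp [hj]
      left
      field_simp
    · simp [hj, flatVec]

theorem numNonzero_flatVec {S : Finset (ZMod n)} (hS : S.Nonempty) :
    numNonzero (flatVec S) = S.card := by
  have hc : (S.card : ℝ) ≠ 0 := by exact_mod_cast hS.card_pos.ne'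
  rw [numNonzero, ← Set.ncard_coe_finset]
  congr 1
  ext j
  have : √(S.card : ℝ) ≠ 0 := Real.sqrt_ne_zero'.2 (by exact_mod_cast hS.card_pos)
  simp [flatVec, this]

/-- `h` is within `ρ / |S|` of the flat vectors supported on `S`. -/
def NearFlat (ρ : ℝ) (S : Finset (ZMod n)) (h : Vec n) : Prop :=
  ‖h‖ = 1 ∧ S.Nonempty ∧ (∀ j ∈ S, |h j ^ 2 - 1 / S.card| ≤ ρ / S.card) ∧
    ∀ j ∉ S, h j ^ 2 ≤ ρ / S.card

/-- A neighborhood sees only the squares of the entries of its center. These are $1/r$ on the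
support and $0$ off it, so signs are irrelevant and the neighborhoods are indexed by supports. -/
theorem mem_nearStationary_iff {Ω : Type*} [MeasurableSpace Ω] {P : Measure Ω} {N : ℕ}
    {x : Fin N → Ω → Vec n} {θ ρ : ℝ} (hβ : 0 < θ * (1 - 3 * θ))
    (hE : expectedObjective P x = popObjective θ) {r : ℕ} {h : Vec n} :
    h ∈ nearStationary P x ρ r ↔ ∃ S : Finset (ZMod n), S.card = r ∧ NearFlat ρ S h := by
  classical
  rw [nearStationary, hE]
  constructor
  · rintro ⟨hh, h₀, hs, hr, hnear⟩
    have hc : numNonzero h₀ = (Finset.univ.filter fun i => h₀ i ≠ 0).card := by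
      rw [numNonzero, ← Set.ncard_coe_finset]; simp
    refine ⟨Finset.univ.filter fun i => h₀ i ≠ 0, hc ▸ hr, hh, ?_, fun j hj => ?_, fun j hj => ?_⟩
    · rw [← Finset.card_pos, ← hc]
      exact numNonzero_pos hs.1
    · have := hnear j
      rwa [sq_eq_inv_numNonzero hβ hs (Finset.mem_filter.1 hj).2, ← hr, hc] at this
    · have := hnear j
      have h0 : h₀ j = 0 := by simpa using hj
      rw [h0, ← hr, hc] at this
      simpa using this
  · rintro ⟨S, rfl, hh, hS, h1, h2⟩
    refine ⟨hh, flatVec S, isStationary_flatVec hβ hS, numNonzero_flatVec hS, fun j => ?_⟩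
    rw [flatVec_sq]
    split_ifs with hj
    · exact h1 j hj
    · rw [sub_zero, abs_of_nonneg (sq_nonneg _)]; exact h2 j hj

end Population

/-! ### Quantitative landscape of the population objective. -/

section Geometry

variable {n : ℕ} [NeZero n]

theorem popForm_self (θ : ℝ) {h : Vec n} (hh : ‖h‖ = 1) :
    popForm θ h h h h = n * (θ * (1 - 3 * θ) * ∑ j, h j ^ 4 + 3 * θ ^ 2) := by
  have : ∑ j, h j * h j * h j * h j = ∑ j, h j ^ 4 := Finset.sum_congr rfl fun j _ => by ring
  rw [popForm, this, real_inner_self_eq_norm_sq, hh]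
  ring

/-- The part built from inner products is constant on the sphere; its contributions $3\theta^2$ and
$3\cdot\theta^2$ cancel. -/
theorem popForm_curvature (θ : ℝ) {h z : Vec n} (hh : ‖h‖ = 1) (hz1 : ‖z‖ = 1)
    (hz : inner ℝ z h = 0) :
    popForm θ h h h h - 3 * popForm θ h h z z =
      n * (θ * (1 - 3 * θ)) * (∑ j, h j ^ 4 - 3 * ∑ j, h j ^ 2 * z j ^ 2) := by
  have : ∑ j, h j * h j * z j * z j = ∑ j, h j ^ 2 * z j ^ 2 :=
    Finset.sum_congr rfl fun j _ => by ring
  rw [popForm_self θ hh, popForm, this, real_inner_self_eq_norm_sq, real_inner_self_eq_norm_sq,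
    hh, hz1, real_inner_comm, hz]
  ring

theorem popForm_slope (θ : ℝ) {h z : Vec n} (hz : inner ℝ z h = 0) :
    popForm θ h h h z = n * (θ * (1 - 3 * θ)) * ∑ j, h j ^ 3 * z j := by
  have : ∑ j, h j * h j * h j * z j = ∑ j, h j ^ 3 * z j :=
    Finset.sum_congr rfl fun j _ => by ring
  rw [popForm, this, real_inner_comm z h, hz]
  ring

theorem nearFlat_singleton {ρ : ℝ} {S : Finset (ZMod n)} {h : Vec n} (hS : S.card = 1)
    (hn : NearFlat ρ S h) : ∃ i, 1 - ρ ≤ h i ^ 2 ∧ ∀ j, j ≠ i → h j ^ 2 ≤ ρ := by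
  obtain ⟨i, rfl⟩ := Finset.card_eq_one.1 hS
  obtain ⟨-, -, h1, h2⟩ := hn
  simp only [Finset.mem_singleton, Finset.card_singleton, Nat.cast_one, div_one, forall_eq] at h1 h2
  exact ⟨i, by linarith [(abs_le.1 h1).1], h2⟩

/-- Near a signed basis vector the population objective is strongly convex. -/
theorem popForm_curvature_of_singleton {θ ρ : ℝ} (hβ : 0 < θ * (1 - 3 * θ)) (hρ0 : 0 < ρ)
    (hρ : ρ < 1 / 1000) {S : Finset (ZMod n)} {h z : Vec n} (hS : S.card = 1)
    (hn : NearFlat ρ S h) (hz1 : ‖z‖ = 1) (hz : inner ℝ z h = 0) :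
    n * (θ * (1 - 3 * θ)) / 2 ≤ popForm θ h h h h - 3 * popForm θ h h z z := by
  classical
  obtain ⟨i, hi, hj⟩ := nearFlat_singleton hS hn
  have hh := hn.1
  have hs := norm_sq_eq_sum h
  have hzs := norm_sq_eq_sum z
  rw [hh, one_pow, Fintype.sum_eq_add_sum_compl i] at hs
  rw [hz1, one_pow, Fintype.sum_eq_add_sum_compl i] at hzs
  rw [inner_eq_sum, Fintype.sum_eq_add_sum_compl i] at hz
  have hm : (1 - ρ) ^ 2 ≤ ∑ j, h j ^ 4 := by
    calc (1 - ρ) ^ 2 ≤ (h i ^ 2) ^ 2 := by gcongr; linarith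
      _ = h i ^ 4 := by ring
      _ ≤ _ := Finset.single_le_sum (f := fun j => h j ^ 4) (fun j _ => by positivity)
        (Finset.mem_univ i)
  have hrest : ∑ j ∈ ({i} : Finset (ZMod n))ᶜ, h j ^ 2 * z j ^ 2 ≤ ρ := by
    calc _ ≤ ∑ j ∈ ({i} : Finset (ZMod n))ᶜ, ρ * z j ^ 2 := by
          refine Finset.sum_le_sum fun j hj' => ?_
          have := hj j (by simpa using hj')
          gcongr
      _ ≤ ρ * 1 := by
          rw [← Finset.mul_sum]
          gcongr
          nlinarith [sq_nonneg (z i)]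
      _ = ρ := mul_one ρ
  -- Orthogonality turns $h_iz_i$ into minus the sum over the other coordinates, to which
  -- Cauchy–Schwarz applies; those entries of `h` have total square at most $\rho$.
  have hdiag : h i ^ 2 * z i ^ 2 ≤ ρ := by
    have hcs := Finset.sum_mul_sq_le_sq_mul_sq ({i} : Finset (ZMod n))ᶜ (fun j => z j)
      (fun j => h j)
    have e1 : h i ^ 2 * z i ^ 2 = (∑ j ∈ ({i} : Finset (ZMod n))ᶜ, z j * h j) ^ 2 := by
      rw [show ∑ j ∈ ({i} : Finset (ZMod n))ᶜ, z j * h j = -(z i * h i) by linarith]; ring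
    rw [e1]
    refine hcs.trans ?_
    have a1 : ∑ j ∈ ({i} : Finset (ZMod n))ᶜ, z j ^ 2 ≤ 1 := by nlinarith [sq_nonneg (z i)]
    have a2 : ∑ j ∈ ({i} : Finset (ZMod n))ᶜ, h j ^ 2 ≤ ρ := by linarith
    have a3 : 0 ≤ ∑ j ∈ ({i} : Finset (ZMod n))ᶜ, h j ^ 2 :=
      Finset.sum_nonneg fun j _ => sq_nonneg _
    nlinarith
  rw [popForm_curvature θ hh hz1 (by rwa [inner_eq_sum, Fintype.sum_eq_add_sum_compl i]),
    div_eq_mul_inv, Fintype.sum_eq_add_sum_compl i (fun j => h j ^ 2 * z j ^ 2)]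
  refine mul_le_mul_of_nonneg_left ?_ (by positivity)
  -- What remains is $(1-\rho)^2-6\rho\ge\frac12$.
  nlinarith

/-- Near a flat vector with at least two nonzero entries there is a descent direction. -/
theorem exists_popForm_curvature_neg {θ ρ : ℝ} (hβ : 0 < θ * (1 - 3 * θ)) (hρ0 : 0 < ρ)
    (hρ : ρ < 1 / 1000) {S : Finset (ZMod n)} {h : Vec n} (hS : 1 < S.card)
    (hn : NearFlat ρ S h) :
    ∃ z : Vec n, ‖z‖ = 1 ∧ inner ℝ z h = 0 ∧
      popForm θ h h h h - 3 * popForm θ h h z z ≤ -(θ * (1 - 3 * θ)) := by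
  classical
  obtain ⟨hh, -, h1, h2⟩ := hn
  obtain ⟨i, hi, k, hk, hik⟩ := Finset.one_lt_card.1 hS
  have hr : (0 : ℝ) < S.card := by exact_mod_cast (zero_lt_one.trans hS)
  have hrn : (S.card : ℝ) ≤ n := by
    have := Finset.card_le_univ S
    rw [ZMod.card] at this
    exact_mod_cast this
  set r : ℝ := (S.card : ℝ) with hrdef
  have lo : ∀ j ∈ S, (1 - ρ) / r ≤ h j ^ 2 := fun j hj => by
    have := (abs_le.1 (h1 j hj)).1
    rw [sub_div]; linarith
  have hi' : ∀ j, h j ^ 2 ≤ (1 + ρ) / r := fun j => by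
    rw [add_div]
    by_cases hj : j ∈ S
    · have := (abs_le.1 (h1 j hj)).2; linarith
    · have := h2 j hj
      have : 0 < 1 / r := by positivity
      linarith
  have hpos : 0 < (1 - ρ) / r := div_pos (by linarith) hr
  set s := h i ^ 2 + h k ^ 2 with hs
  have li := lo i hi
  have lk := lo k hk
  have hs0 : 0 < s := by linarith
  have hss : √s ^ 2 = s := Real.sq_sqrt hs0.le
  have hsn : √s ≠ 0 := Real.sqrt_ne_zero'.2 hs0
  -- The direction that rotates two large coordinates of `h` into each other, moving mass from one
  -- to the other.
  set z : Vec n := WithLp.toLp 2 fun j => if j = i then h k / √s else if j = k then -h i / √s else 0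
    with hz
  have sum2 : ∀ F : ZMod n → ℝ, (∀ j, j ≠ i → j ≠ k → F j = 0) → ∑ j, F j = F i + F k := by
    intro F hF
    rw [← Finset.sum_subset (Finset.subset_univ {i, k})]
    · exact Finset.sum_pair hik
    · intro j _ hj
      simp only [Finset.mem_insert, Finset.mem_singleton, not_or] at hj
      exact hF j hj.1 hj.2
  have zi : z i = h k / √s := by simp [hz]
  have zk : z k = -h i / √s := by simp [hz, hik.symm]
  have z0 : ∀ j, j ≠ i → j ≠ k → z j = 0 := fun j h1 h2 => by simp [hz, h1, h2]
  have hz1 : ‖z‖ = 1 := by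
    rw [← sq_eq_sq₀ (norm_nonneg _) zero_le_one, norm_sq_eq_sum,
      sum2 _ (fun j h1 h2 => by rw [z0 j h1 h2]; simp), zi, zk, div_pow, div_pow, hss]
    field_simp
    rw [hs]; ring
  have hzh : inner ℝ z h = 0 := by
    rw [inner_eq_sum, sum2 _ (fun j h1 h2 => by rw [z0 j h1 h2]; simp), zi, zk]
    ring
  refine ⟨z, hz1, hzh, ?_⟩
  rw [popForm_curvature θ hh hz1 hzh]
  -- The sum is $2h_i^2h_k^2/(h_i^2+h_k^2)$, the harmonic mean of two numbers that are at least
  -- $(1-\rho)/r$.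
  have e1 : (1 - ρ) / r ≤ ∑ j, h j ^ 2 * z j ^ 2 := by
    rw [sum2 _ (fun j h1 h2 => by rw [z0 j h1 h2]; simp), zi, zk, div_pow, div_pow, hss]
    have : h i ^ 2 * (h k ^ 2 / s) + h k ^ 2 * ((-h i) ^ 2 / s) = 2 * h i ^ 2 * h k ^ 2 / s := by
      ring
    rw [this, le_div_iff₀ hs0, hs]
    nlinarith [mul_nonneg (sub_nonneg.2 li) (sub_nonneg.2 lk), sq_nonneg (h i), sq_nonneg (h k)]
  have e2 : ∑ j, h j ^ 4 ≤ (1 + ρ) / r := by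
    calc ∑ j, h j ^ 4 ≤ ∑ j, (1 + ρ) / r * h j ^ 2 := by
          refine Finset.sum_le_sum fun j _ => ?_
          rw [show h j ^ 4 = h j ^ 2 * h j ^ 2 by ring]
          exact mul_le_mul_of_nonneg_right (hi' j) (sq_nonneg _)
      _ = _ := by rw [← Finset.mul_sum, ← norm_sq_eq_sum, hh]; ring
  have hn0 : (0 : ℝ) < n := hr.trans_le hrn
  have e3 : ∑ j, h j ^ 4 - 3 * ∑ j, h j ^ 2 * z j ^ 2 ≤ -(1 / n) := by
    have : 1 / (n : ℝ) ≤ 1 / r := by gcongr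
    have e4 : (1 + ρ) / r - 3 * ((1 - ρ) / r) = -(2 - 4 * ρ) * (1 / r) := by ring
    have : 0 < 1 / r := by positivity
    nlinarith
  calc _ ≤ n * (θ * (1 - 3 * θ)) * (-(1 / n)) := by gcongr
    _ = _ := by field_simp

/-- Almost stationary points are near flat vectors. -/
theorem exists_nearFlat {ρ : ℝ} (hρ0 : 0 < ρ) (hρ : ρ < 1 / 1000) (hn4 : 4 ≤ n) {h : Vec n}
    (hh : ‖h‖ = 1)
    (hε : ∀ j, |h j ^ 3 - (∑ i, h i ^ 4) * h j| ≤ ρ ^ 2 / n ^ 2) :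
    ∃ S : Finset (ZMod n), NearFlat ρ S h := by
  classical
  have hn4' : (4 : ℝ) ≤ n := by exact_mod_cast hn4
  have hn0 : (0 : ℝ) < n := by linarith
  set m := ∑ i, h i ^ 4 with hm
  have hsum : ∑ i, h i ^ 2 = 1 := by rw [← norm_sq_eq_sum, hh, one_pow]
  have hmn : 1 ≤ n * m := by
    have h1 := sq_sum_le_card_mul_sum_sq (s := (Finset.univ : Finset (ZMod n)))
      (f := fun i => h i ^ 2)
    rw [hsum, Finset.card_univ, ZMod.card] at h1
    have h2 : ∑ i, (h i ^ 2) ^ 2 = m := Finset.sum_congr rfl fun i _ => by ring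
    rw [h2] at h1
    linarith
  have hm0 : 0 < m := by
    by_contra! h0
    nlinarith
  -- The squared hypothesis: each $h_j^2$ is close to $0$ or to $m$, and the threshold $m/2$ below
  -- separates the two cases.
  have hu : ∀ j, h j ^ 2 * (h j ^ 2 - m) ^ 2 ≤ ρ ^ 4 / n ^ 4 := by
    intro j
    have h1 := hε j
    have h2 := pow_le_pow_left₀ (abs_nonneg _) h1 2
    rw [sq_abs] at h2
    calc _ = (h j ^ 3 - m * h j) ^ 2 := by ring
      _ ≤ _ := h2
      _ = _ := by rw [div_pow]; ring
  set S := Finset.univ.filter fun j => m / 2 < h j ^ 2 with hS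
  -- $m$ is the average of the $h_j^2$ with weights $h_j^2$, so these cannot all be at most $m/2$.
  have hSne : S.Nonempty := by
    by_contra hne
    rw [Finset.not_nonempty_iff_eq_empty, hS, Finset.filter_eq_empty_iff] at hne
    have : m ≤ m / 2 := by
      calc m ≤ ∑ i, m / 2 * h i ^ 2 := by
            refine Finset.sum_le_sum fun i _ => ?_
            rw [show h i ^ 4 = h i ^ 2 * h i ^ 2 by ring]
            exact mul_le_mul_of_nonneg_right (not_lt.1 (hne (Finset.mem_univ i))) (sq_nonneg _)
        _ = m / 2 := by rw [← Finset.mul_sum, hsum, mul_one]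
    linarith
  have hr : (0 : ℝ) < S.card := by exact_mod_cast hSne.card_pos
  have hrn : (S.card : ℝ) ≤ n := by
    have := Finset.card_le_univ S
    rw [ZMod.card] at this
    exact_mod_cast this
  have hin : ∀ j ∈ S, |h j ^ 2 - m| ≤ ρ ^ 2 / n := by
    intro j hj
    have h1 : m / 2 < h j ^ 2 := (Finset.mem_filter.1 hj).2
    have h2 : m / 2 * (h j ^ 2 - m) ^ 2 ≤ ρ ^ 4 / n ^ 4 :=
      (mul_le_mul_of_nonneg_right h1.le (sq_nonneg _)).trans (hu j)
    refine abs_le_of_sq_le_sq ?_ (by positivity)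
    -- The factor $m$ is traded for $1/n$ by the power mean bound `hmn`; the surplus $2/n$ is then
    -- at most $1$.
    have h3 : (h j ^ 2 - m) ^ 2 ≤ 2 * n * (ρ ^ 4 / n ^ 4) := by
      have h4 : (h j ^ 2 - m) ^ 2 ≤ n * m * (h j ^ 2 - m) ^ 2 :=
        le_mul_of_one_le_left (sq_nonneg _) hmn
      have h5 := mul_le_mul_of_nonneg_left h2 (by positivity : (0 : ℝ) ≤ 2 * n)
      linarith
    refine h3.trans ?_
    rw [div_pow, show 2 * (n : ℝ) * (ρ ^ 4 / n ^ 4) = (ρ ^ 2) ^ 2 / n ^ 2 * (2 / n) by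
      field_simp]
    refine mul_le_of_le_one_right (by positivity) ?_
    rw [div_le_one hn0]; linarith
  have hout : ∀ j ∉ S, h j ^ 2 ≤ 4 * ρ ^ 4 / n ^ 2 := by
    intro j hj
    have h1 : h j ^ 2 ≤ m / 2 := not_lt.1 fun hlt => hj (Finset.mem_filter.2 ⟨Finset.mem_univ _, hlt⟩)
    have h2 : (m / 2) ^ 2 ≤ (h j ^ 2 - m) ^ 2 := by nlinarith
    have h3 := (mul_le_mul_of_nonneg_left h2 (sq_nonneg (h j))).trans (hu j)
    have h4 : h j ^ 2 ≤ (n * m) ^ 2 * h j ^ 2 :=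
      le_mul_of_one_le_left (sq_nonneg _) (one_le_pow₀ hmn)
    have h5 := mul_le_mul_of_nonneg_left h3 (by positivity : (0 : ℝ) ≤ 4 * n ^ 2)
    calc h j ^ 2 ≤ (n * m) ^ 2 * h j ^ 2 := h4
      _ = 4 * n ^ 2 * (h j ^ 2 * (m / 2) ^ 2) := by ring
      _ ≤ _ := h5
      _ = _ := by field_simp
  have hρ4 : 4 * ρ ^ 4 ≤ ρ / 2 := by
    have : ρ ^ 3 ≤ (1 / 1000) ^ 3 := by gcongr
    nlinarith
  have hρ2 : 2 * ρ ^ 2 ≤ ρ / 2 := by nlinarith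
  have hrest : |∑ j ∈ S, h j ^ 2 - 1| ≤ 4 * ρ ^ 4 := by
    have h1 := Finset.sum_add_sum_compl S fun j => h j ^ 2
    rw [hsum] at h1
    have h2 : ∑ j ∈ Sᶜ, h j ^ 2 ≤ 4 * ρ ^ 4 := by
      calc ∑ j ∈ Sᶜ, h j ^ 2 ≤ ∑ j ∈ Sᶜ, 4 * ρ ^ 4 / n ^ 2 :=
            Finset.sum_le_sum fun j hj => hout j (Finset.mem_compl.1 hj)
        _ = (Sᶜ).card * (4 * ρ ^ 4 / n ^ 2) := by rw [Finset.sum_const, nsmul_eq_mul]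
        _ ≤ n * (4 * ρ ^ 4 / n ^ 2) := by
            gcongr
            have := Finset.card_le_univ Sᶜ
            rwa [ZMod.card] at this
        _ = 4 * ρ ^ 4 / n := by field_simp
        _ ≤ 4 * ρ ^ 4 := div_le_self (by positivity) (by linarith)
    have h3 : 0 ≤ ∑ j ∈ Sᶜ, h j ^ 2 := Finset.sum_nonneg fun j _ => sq_nonneg _
    rw [abs_le]; constructor <;> linarith
  -- Summation over `S`, which carries almost all the mass, identifies $m$ with $1/|S|$ up to this
  -- error.
  have hrm : |S.card * m - 1| ≤ S.card * (ρ ^ 2 / n) + 4 * ρ ^ 4 := by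
    have h1 : |∑ j ∈ S, (h j ^ 2 - m)| ≤ S.card * (ρ ^ 2 / n) := by
      refine (Finset.abs_sum_le_sum_abs _ _).trans ((Finset.sum_le_sum hin).trans ?_)
      rw [Finset.sum_const, nsmul_eq_mul]
    rw [Finset.sum_sub_distrib, Finset.sum_const, nsmul_eq_mul] at h1
    rw [abs_le] at *
    constructor <;> linarith
  have hrd : S.card * (ρ ^ 2 / n) ≤ ρ ^ 2 := by
    rw [mul_div_left_comm]
    exact mul_le_of_le_one_right (sq_nonneg _) ((div_le_one hn0).2 hrn)
  refine ⟨S, hh, hSne, fun j hj => ?_, fun j hj => ?_⟩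
  · have h1 := mul_le_mul_of_nonneg_left (hin j hj) hr.le
    rw [← abs_of_pos hr, ← abs_mul, abs_of_pos hr] at h1
    rw [le_div_iff₀ hr, ← abs_of_pos hr, ← abs_mul, abs_of_pos hr]
    have h2 : (h j ^ 2 - 1 / (S.card : ℝ)) * S.card
        = S.card * (h j ^ 2 - m) + (S.card * m - 1) := by
      field_simp; ring
    rw [h2]
    refine (abs_add_le _ _).trans ?_
    linarith
  · refine (hout j hj).trans ?_
    have h1 : ρ / n ≤ ρ / S.card := by gcongr
    refine le_trans ?_ h1
    rw [div_le_div_iff₀ (by positivity) hn0]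
    nlinarith [mul_pos hn0 hn0, mul_pos hρ0 hn0]

/-- Away from the flat vectors the population gradient is large. -/
theorem exists_popForm_slope {θ ρ : ℝ} (hβ : 0 < θ * (1 - 3 * θ)) (hρ0 : 0 < ρ)
    (hρ : ρ < 1 / 1000) (hn4 : 4 ≤ n) {h : Vec n} (hh : ‖h‖ = 1)
    (hfar : ∀ S : Finset (ZMod n), ¬ NearFlat ρ S h) :
    ∃ z : Vec n, ‖z‖ = 1 ∧ inner ℝ z h = 0 ∧
      θ * (1 - 3 * θ) * ρ ^ 2 / n ≤ popForm θ h h h z := by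
  have hn0 : (0 : ℝ) < n := by exact_mod_cast (by omega : 0 < n)
  set m := ∑ i, h i ^ 4 with hm
  -- The tangential part of the entrywise cube of `h`. Its direction has slope proportional to its
  -- norm, and smallness of that norm would put `h` near a flat vector.
  set g : Vec n := WithLp.toLp 2 fun j => h j ^ 3 - m * h j with hg
  have hsum : ∑ i, h i ^ 2 = 1 := by rw [← norm_sq_eq_sum, hh, one_pow]
  have hlarge : ρ ^ 2 / n ^ 2 < ‖g‖ := by
    by_contra! hle
    obtain ⟨S, hS⟩ := exists_nearFlat hρ0 hρ hn4 hh fun j => by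
      have := (abs_coord_le_norm g j).trans hle
      simpa [hg] using this
    exact hfar S hS
  have hg0 : 0 < ‖g‖ := lt_of_le_of_lt (by positivity) hlarge
  have hgh : inner ℝ g h = 0 := by
    rw [inner_eq_sum]
    have : ∀ j, g j * h j = h j ^ 4 - m * h j ^ 2 := fun j => by simp [hg]; ring
    simp only [this]
    rw [Finset.sum_sub_distrib, ← Finset.mul_sum, hsum, ← hm]
    ring
  have hzh : inner ℝ (‖g‖⁻¹ • g) h = 0 := by rw [inner_smul_left, hgh, mul_zero]
  refine ⟨‖g‖⁻¹ • g, ?_, hzh, ?_⟩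
  · rw [norm_smul, norm_inv, norm_norm, inv_mul_cancel₀ hg0.ne']
  rw [popForm_slope θ hzh]
  have h1 : ∑ j, h j ^ 3 * (‖g‖⁻¹ • g) j = ‖g‖ := by
    have h2 : ∑ j, h j ^ 3 * g j = ‖g‖ ^ 2 := by
      rw [norm_sq_eq_sum]
      have : ∀ j, h j ^ 3 * g j = g j ^ 2 + m * (g j * h j) := fun j => by simp [hg]; ring
      simp only [this]
      rw [Finset.sum_add_distrib, ← Finset.mul_sum, ← inner_eq_sum, hgh]
      ring
    have h3 : ∑ j, h j ^ 3 * (‖g‖⁻¹ • g) j = ‖g‖⁻¹ * ∑ j, h j ^ 3 * g j := by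
      rw [Finset.mul_sum]
      refine Finset.sum_congr rfl fun j _ => by simp; ring
    rw [h3, h2]
    field_simp
  rw [h1]
  calc θ * (1 - 3 * θ) * ρ ^ 2 / n = n * (θ * (1 - 3 * θ)) * (ρ ^ 2 / n ^ 2) := by field_simp
    _ ≤ _ := by gcongr

end Geometry

/-! ### Circulant matrices, matrix powers and the effective preconditioner. -/

section MatrixAlgebra

variable {n : ℕ} [NeZero n]

theorem act_apply (M : Matrix (ZMod n) (ZMod n) ℝ) (h : Vec n) (i : ZMod n) :
    act M h i = ∑ j, M i j * h j := rfl

theorem act_mul (A B : Matrix (ZMod n) (ZMod n) ℝ) (h : Vec n) :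
    act (A * B) h = act A (act B h) := by
  simp [act, Matrix.mulVec_mulVec]

@[simp]
theorem act_one (h : Vec n) : act (1 : Matrix (ZMod n) (ZMod n) ℝ) h = h := by
  simp [act]

theorem act_sub (A : Matrix (ZMod n) (ZMod n) ℝ) (u v : Vec n) :
    act A (u - v) = act A u - act A v := by
  ext i; simp [act_apply, mul_sub, Finset.sum_sub_distrib]

theorem inner_act (A : Matrix (ZMod n) (ZMod n) ℝ) (u v : Vec n) :
    inner ℝ (act A u) v = inner ℝ u (act A.transpose v) := by
  simp only [inner_eq_sum, act_apply, Matrix.transpose_apply, Finset.sum_mul, Finset.mul_sum]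
  rw [Finset.sum_comm]
  refine Finset.sum_congr rfl fun j _ => Finset.sum_congr rfl fun i _ => by ring

theorem inner_act_nonneg {M : Matrix (ZMod n) (ZMod n) ℝ} (hM : M.PosSemidef) (u : Vec n) :
    0 ≤ inner ℝ u (act M u) := by
  have := hM.dotProduct_mulVec_nonneg (fun j => u j)
  rw [inner_eq_sum]
  simpa [dotProduct, act] using this

theorem inner_act_act_of_orthogonal {U : Matrix (ZMod n) (ZMod n) ℝ} (hU : U.transpose * U = 1)
    (u v : Vec n) : inner ℝ (act U u) (act U v) = inner ℝ u v := by
  rw [inner_act, ← act_mul, hU, act_one]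

theorem norm_act_of_orthogonal {U : Matrix (ZMod n) (ZMod n) ℝ} (hU : U.transpose * U = 1)
    (u : Vec n) : ‖act U u‖ = ‖u‖ := by
  rw [← sq_eq_sq₀ (norm_nonneg _) (norm_nonneg _), ← real_inner_self_eq_norm_sq,
    ← real_inner_self_eq_norm_sq, inner_act_act_of_orthogonal hU]

theorem act_bijective_of_orthogonal {U : Matrix (ZMod n) (ZMod n) ℝ} (hU : U.transpose * U = 1) :
    Function.Bijective (act U) := by
  refine Function.bijective_iff_has_inverse.2 ⟨act U.transpose, fun u => ?_, fun u => ?_⟩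
  · rw [← act_mul, hU, act_one]
  · rw [← act_mul, mul_eq_one_comm.1 hU, act_one]

theorem circ_circConv (x f : Vec n) : circ (circConv x f) = circ x * circ f := by
  rw [circ, circ, circ, Matrix.circulant_mul]
  congr 1
  funext k
  simp only [circConv, Matrix.mulVec, dotProduct, Matrix.circulant_apply]
  exact Fintype.sum_equiv (Equiv.subLeft k) _ _ fun j => by simp

theorem isUnit_circ {f : Vec n} (hf : ConvInvertible f) : IsUnit (circ f) := by
  obtain ⟨g, hg⟩ := hf
  have h1 : circ f * circ g = 1 := by
    rw [← circ_circConv, hg, circ, ← Matrix.circulant_single_one]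
    congr 1
  exact IsUnit.of_mul_eq_one _ h1

theorem commute_circ (u v : Vec n) : Commute (circ u) (circ v) :=
  Matrix.circulant_mul_comm _ _

theorem circ_transpose (u : Vec n) : (circ u).transpose = circ (WithLp.toLp 2 fun j => u (-j)) :=
  Matrix.transpose_circulant _

/-- The transpose of a circulant matrix is circulant. All commutation relations behind the
cancellation of the filter come from this. -/
theorem commute_circ_transpose_mul (u v : Vec n) :
    Commute (circ u) ((circ v).transpose * circ v) := by
  rw [circ_transpose]
  exact (commute_circ _ _).mul_right (commute_circ _ _)

theorem commute_circ_gramMatrix {N : ℕ} (θ : ℝ) (u : Vec n) (x : Fin N → Vec n) :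
    Commute (circ u) (gramMatrix θ x) :=
  (Commute.sum_right _ _ _ fun i _ => commute_circ_transpose_mul u (x i)).smul_right _

theorem gramMatrix_circConv {N : ℕ} (θ : ℝ) (x : Fin N → Vec n) (f : Vec n) :
    gramMatrix θ (fun i => circConv (x i) f) =
      (circ f).transpose * gramMatrix θ x * circ f := by
  simp only [gramMatrix, circ_circConv, Matrix.transpose_mul, Matrix.mul_smul, Matrix.smul_mul,
    Finset.mul_sum, Finset.sum_mul, Matrix.mul_assoc]

theorem transpose_gramMatrix {N : ℕ} (θ : ℝ) (x : Fin N → Vec n) :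
    (gramMatrix θ x).transpose = gramMatrix θ x := by
  simp [gramMatrix, Matrix.transpose_sum]

theorem spectrum_pos {A : Matrix (ZMod n) (ZMod n) ℝ} (hA : A.PosDef) {t : ℝ}
    (ht : t ∈ spectrum ℝ A) : 0 < t := by
  rw [hA.1.spectrum_real_eq_range_eigenvalues] at ht
  obtain ⟨i, rfl⟩ := ht
  exact hA.eigenvalues_pos i

/-- The spectrum avoids $0$, the only point where a real power may fail to be continuous; this gives
the functional calculus for negative exponents. -/
theorem continuousOn_rpow_spectrum {A : Matrix (ZMod n) (ZMod n) ℝ} (hA : A.PosDef) (s : ℝ) :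
    ContinuousOn (fun t : ℝ => t ^ s) (spectrum ℝ A) :=
  fun t ht => (Real.continuousAt_rpow_const t s (Or.inl (spectrum_pos hA ht).ne')).continuousWithinAt

theorem matPow_mul {A : Matrix (ZMod n) (ZMod n) ℝ} (hA : A.PosDef) (s t : ℝ) :
    matPow A s * matPow A t = matPow A (s + t) := by
  rw [matPow, matPow, ← cfc_mul _ _ A (continuousOn_rpow_spectrum hA s)
    (continuousOn_rpow_spectrum hA t)]
  exact cfc_congr fun r hr => (Real.rpow_add (spectrum_pos hA hr) s t).symm

theorem matPow_one {A : Matrix (ZMod n) (ZMod n) ℝ} (hA : A.PosDef) : matPow A 1 = A := by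
  simp only [matPow, Real.rpow_one]
  exact cfc_id' ℝ A hA.1.isSelfAdjoint

theorem matPow_zero {A : Matrix (ZMod n) (ZMod n) ℝ} (hA : A.PosDef) : matPow A 0 = 1 := by
  simp only [matPow, Real.rpow_zero]
  exact cfc_const_one ℝ A hA.1.isSelfAdjoint

theorem transpose_matPow (A : Matrix (ZMod n) (ZMod n) ℝ) (s : ℝ) :
    (matPow A s).transpose = matPow A s := by
  have : IsSelfAdjoint (matPow A s) := cfc_predicate _ A
  simpa [IsSelfAdjoint, Matrix.star_eq_conjTranspose] using this

theorem commute_matPow {A B : Matrix (ZMod n) (ZMod n) ℝ} (h : Commute A B) (s : ℝ) :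
    Commute (matPow A s) B := h.cfc_real _

theorem posDef_transpose_mul_circ {f : Vec n} (hf : ConvInvertible f) :
    ((circ f).transpose * circ f).PosDef := by
  have := Matrix.PosDef.conjTranspose_mul_self (circ f)
    (Matrix.mulVec_injective_of_isUnit (isUnit_circ hf))
  simpa using this

theorem posDef_gramMatrix_circConv {N : ℕ} {θ : ℝ} {x : Fin N → Vec n} {f : Vec n}
    (hf : ConvInvertible f) (hD : (gramMatrix θ x).PosDef) :
    (gramMatrix θ (fun i => circConv (x i) f)).PosDef := by
  have := hD.conjTranspose_mul_mul_same (B := circ f)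
    (Matrix.mulVec_injective_of_isUnit (isUnit_circ hf))
  rw [gramMatrix_circConv]
  simpa using this

theorem circ_mul_inv {f : Vec n} (hf : ConvInvertible f) : circ f * (circ f)⁻¹ = 1 :=
  Matrix.mul_nonsing_inv _ ((Matrix.isUnit_iff_isUnit_det _).1 (isUnit_circ hf))

theorem matPow_half_mul_half {A : Matrix (ZMod n) (ZMod n) ℝ} (hA : A.PosDef) :
    matPow A (1 / 2) * matPow A (1 / 2) = A := by
  rw [matPow_mul hA, show (1 : ℝ) / 2 + 1 / 2 = 1 by norm_num, matPow_one hA]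

theorem rotation_orthogonal {f : Vec n} (hf : ConvInvertible f) :
    (rotation f).transpose * rotation f = 1 := by
  have h1 := circ_mul_inv hf
  have h2 : ((circ f)⁻¹).transpose * (circ f).transpose = 1 := by
    rw [← Matrix.transpose_mul, h1, Matrix.transpose_one]
  rw [rotation, Matrix.transpose_mul, transpose_matPow]
  calc _ = ((circ f)⁻¹).transpose * (matPow ((circ f).transpose * circ f) (1 / 2) *
        matPow ((circ f).transpose * circ f) (1 / 2)) * (circ f)⁻¹ := by
        simp only [Matrix.mul_assoc]
    _ = (((circ f)⁻¹).transpose * (circ f).transpose) * (circ f * (circ f)⁻¹) := by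
        rw [matPow_half_mul_half (posDef_transpose_mul_circ hf)]
        simp only [Matrix.mul_assoc]
    _ = 1 := by rw [h1, h2, mul_one]

/-- The effective preconditioner `C_f R (C_fᵀ C_f)^{1/2} C_f⁻¹` is the positive square root of the
inverse of the Gram matrix of the unobserved inputs. -/
theorem circ_mul_preconditioner_mul_rotation {N : ℕ} {θ : ℝ} {x : Fin N → Vec n} {f : Vec n}
    (hf : ConvInvertible f) (hD : (gramMatrix θ x).PosDef) :
    (circ f * preconditioner θ (fun i => circConv (x i) f) * rotation f).PosSemidef ∧
      (circ f * preconditioner θ (fun i => circConv (x i) f) * rotation f) *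
        (circ f * preconditioner θ (fun i => circConv (x i) f) * rotation f) *
        gramMatrix θ x = 1 := by
  have hG := posDef_gramMatrix_circConv hf hD
  have hA := posDef_transpose_mul_circ hf
  have hGeq := gramMatrix_circConv θ x f
  have cFG := commute_circ_gramMatrix θ f (fun i => circConv (x i) f)
  have cFA := commute_circ_transpose_mul f f
  have cAG : Commute ((circ f).transpose * circ f) (gramMatrix θ (fun i => circConv (x i) f)) := by
    rw [circ_transpose]
    exact (commute_circ_gramMatrix θ _ _).mul_left cFG
  have cFD := commute_circ_gramMatrix θ f x
  -- Moving $C_f$ past both matrix powers cancels it against the inverse inside `rotation f`.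
  have hM : circ f * preconditioner θ (fun i => circConv (x i) f) * rotation f =
      preconditioner θ (fun i => circConv (x i) f) *
        matPow ((circ f).transpose * circ f) (1 / 2) := by
    have c1 : Commute (preconditioner θ (fun i => circConv (x i) f)) (circ f) :=
      commute_matPow cFG.symm _
    have c2 : Commute (matPow ((circ f).transpose * circ f) (1 / 2)) (circ f) :=
      commute_matPow cFA.symm _
    rw [rotation, ← c1.eq, Matrix.mul_assoc, ← Matrix.mul_assoc (circ f), ← c2.eq,
      Matrix.mul_assoc (matPow _ _), circ_mul_inv hf, mul_one]
  rw [hM]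
  set G := gramMatrix θ (fun i => circConv (x i) f) with hGdef
  set A := (circ f).transpose * circ f with hAdef
  have cSG : Commute (matPow A (1 / 2)) G := commute_matPow cAG _
  constructor
  · have c3 : Commute (matPow G (-1 / 4)) (matPow A (1 / 2)) := commute_matPow cSG.symm _
    -- Splitting into quarter powers writes the product of commuting positive matrices as $Y^\top
    -- Y$, hence positive semidefinite.
    have e1 : preconditioner θ (fun i => circConv (x i) f) * matPow A (1 / 2) =
        (matPow A (1 / 4) * matPow G (-1 / 4)).conjTranspose *
          (matPow A (1 / 4) * matPow G (-1 / 4)) := by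
      have e2 : preconditioner θ (fun i => circConv (x i) f)
          = matPow G (-1 / 4) * matPow G (-1 / 4) := by
        rw [matPow_mul hG, preconditioner]; norm_num; rfl
      have e3 : matPow A (1 / 4) * matPow A (1 / 4) = matPow A (1 / 2) := by
        rw [matPow_mul hA]; norm_num
      rw [e2, Matrix.conjTranspose_eq_transpose_of_trivial, Matrix.transpose_mul, transpose_matPow,
        transpose_matPow, Matrix.mul_assoc, c3.eq, ← e3]
      simp only [Matrix.mul_assoc]
    rw [e1]
    exact Matrix.posSemidef_conjTranspose_mul_self _
  · have c4 : Commute (preconditioner θ (fun i => circConv (x i) f)) (matPow A (1 / 2)) :=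
      commute_matPow cSG.symm _
    have e1 : A * gramMatrix θ x = G := by
      rw [hGeq, hAdef, Matrix.mul_assoc, Matrix.mul_assoc, cFD.eq]
    have e2 : preconditioner θ (fun i => circConv (x i) f) *
        preconditioner θ (fun i => circConv (x i) f) * G = 1 := by
      have := matPow_mul hG (-1 / 2) (-1 / 2)
      have h2 := matPow_mul hG (-1 / 2 + -1 / 2) 1
      rw [matPow_one hG, show (-1 / 2 + -1 / 2 + 1 : ℝ) = 0 by norm_num, matPow_zero hG] at h2
      rw [preconditioner, ← hGdef, this, h2]
    set R := preconditioner θ (fun i => circConv (x i) f)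
    set S := matPow A (1 / 2) with hS
    calc R * S * (R * S) * gramMatrix θ x = R * (S * R) * (S * gramMatrix θ x) := by
          simp only [Matrix.mul_assoc]
      _ = R * R * ((S * S) * gramMatrix θ x) := by
          rw [← c4.eq]; simp only [Matrix.mul_assoc]
      _ = 1 := by rw [hS, matPow_half_mul_half hA, e1, e2]

/-- Each coordinate of $(D-I)v$ is at most $s\|v\|_1\le s\sqrt n\,\|v\|$, and there are $n$
coordinates. -/
theorem norm_act_sub_self_le {D : Matrix (ZMod n) (ZMod n) ℝ} {s : ℝ} (hs : 0 ≤ s)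
    (hD : ∀ a b, |D a b - if a = b then 1 else 0| ≤ s) (v : Vec n) :
    ‖act D v - v‖ ≤ n * s * ‖v‖ := by
  have h1 : (∑ j, |v j|) ^ 2 ≤ n * ‖v‖ ^ 2 := by
    have := sq_sum_le_card_mul_sum_sq (s := (Finset.univ : Finset (ZMod n))) (f := fun j => |v j|)
    rw [Finset.card_univ, ZMod.card] at this
    simpa [norm_sq_eq_sum] using this
  have h2 : ∀ i, |(act D v - v) i| ≤ s * ∑ j, |v j| := by
    intro i
    have : (act D v - v) i = ∑ j, (D i j - if i = j then 1 else 0) * v j := by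
      simp [act_apply, sub_mul]
    rw [this, Finset.mul_sum]
    refine (Finset.abs_sum_le_sum_abs _ _).trans (Finset.sum_le_sum fun j _ => ?_)
    rw [abs_mul]
    exact mul_le_mul_of_nonneg_right (hD i j) (abs_nonneg _)
  refine abs_le_of_sq_le_sq' ?_ (by positivity) |>.2
  rw [norm_sq_eq_sum]
  calc ∑ i, (act D v - v) i ^ 2 ≤ ∑ _i : ZMod n, (s * ∑ j, |v j|) ^ 2 := by
        refine Finset.sum_le_sum fun i _ => ?_
        rw [← sq_abs]
        exact pow_le_pow_left₀ (abs_nonneg _) (h2 i) 2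
    _ = n * (s ^ 2 * (∑ j, |v j|) ^ 2) := by
        simp [mul_pow]
    _ ≤ n * (s ^ 2 * (n * ‖v‖ ^ 2)) := by gcongr
    _ = _ := by ring

theorem posDef_of_near_one {D : Matrix (ZMod n) (ZMod n) ℝ} (hDt : D.transpose = D) {s : ℝ}
    (hs : 0 ≤ s) (hs1 : n * s < 1) (hD : ∀ a b, |D a b - if a = b then 1 else 0| ≤ s) :
    D.PosDef := by
  refine Matrix.PosDef.of_dotProduct_mulVec_pos (by simpa [Matrix.IsHermitian] using hDt) ?_
  intro x hx
  set v : Vec n := WithLp.toLp 2 x with hv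
  have hv0 : 0 < ‖v‖ := norm_pos_iff.2 fun h => hx (by
    funext j
    have := congrArg (fun w : Vec n => w j) h
    simpa [hv] using this)
  have h1 : star x ⬝ᵥ D.mulVec x = inner ℝ v (act D v) := by
    rw [inner_eq_sum]; simp [dotProduct, act, hv]
  rw [h1]
  have h2 := norm_act_sub_self_le hs hD v
  have h3 := abs_real_inner_le_norm v (act D v - v)
  rw [inner_sub_right, real_inner_self_eq_norm_sq] at h3
  have h4 := (abs_le.1 h3).1
  nlinarith [mul_pos hv0 hv0, mul_le_mul_of_nonneg_left h2 hv0.le]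

/-- The inverse square root of a matrix close to the identity is close to the identity. -/
theorem norm_act_invSqrt_sub_self_le {D M : Matrix (ZMod n) (ZMod n) ℝ} (hM : M.PosSemidef)
    (hMD : M * M * D = 1) {s : ℝ} (hs : 0 ≤ s) (hs1 : n * s ≤ 1 / 2)
    (hD : ∀ a b, |D a b - if a = b then 1 else 0| ≤ s) (u : Vec n) :
    ‖act M u - u‖ ≤ 2 * (n * s) * ‖u‖ := by
  have hDM := mul_eq_one_comm.1 hMD
  set w := act (M * M) u with hw
  have hDw : act D w = u := by rw [hw, ← act_mul, hDM, act_one]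
  have h1 := norm_act_sub_self_le hs hD w
  rw [hDw, norm_sub_rev] at h1
  have h2 := norm_le_norm_sub_add w u
  have h3 : ‖w - u‖ ≤ 2 * (n * s) * ‖u‖ := by
    have : n * s * ‖w‖ ≤ n * s * (‖w - u‖ + ‖u‖) := by gcongr
    nlinarith [norm_nonneg (w - u), norm_nonneg u]
  refine le_trans ?_ h3
  set p := act M u - u with hp
  -- From $(M+I)(M-I)=M^2-I$: as `M` is positive semidefinite, $M+I$ does not decrease norms, so the
  -- error of $M$ is at most that of $M^2=D^{-1}$.
  have h4 : act M p + p = w - u := by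
    rw [hp, act_sub, hw, act_mul]; abel
  have h5 : ‖p‖ ^ 2 ≤ ‖p‖ * ‖w - u‖ := by
    rw [← h4]
    refine le_trans ?_ (real_inner_le_norm p (act M p + p))
    rw [inner_add_right, real_inner_self_eq_norm_sq]
    linarith [inner_act_nonneg hM p]
  by_contra! hlt
  have : 0 < ‖p‖ := lt_of_le_of_lt (norm_nonneg _) hlt
  nlinarith

end MatrixAlgebra

/-! ### Transfer of the population landscape to the empirical objective. -/

section Landscape

variable {n : ℕ} [NeZero n]

/-- The quadrilinear form with coefficients `T`. -/
def tensorForm (T : ZMod n → ZMod n → ZMod n → ZMod n → ℝ) (u₁ u₂ u₃ u₄ : Vec n) : ℝ :=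
  ∑ a, ∑ b, ∑ c, ∑ d, T a b c d * (u₁ a * u₂ b * u₃ c * u₄ d)

theorem sum_abs_le_sqrt_mul_norm (u : Vec n) : ∑ j, |u j| ≤ √n * ‖u‖ := by
  have := sq_sum_le_card_mul_sum_sq (s := (Finset.univ : Finset (ZMod n))) (f := fun j => |u j|)
  rw [Finset.card_univ, ZMod.card] at this
  simp only [sq_abs, ← norm_sq_eq_sum] at this
  refine (abs_le_of_sq_le_sq' ?_ (by positivity)).2
  rwa [mul_pow, Real.sq_sqrt (Nat.cast_nonneg n)]

/-- Each of the four $\ell_1$ norms costs a factor $\sqrt n$. This passes from moment errors to all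
unit vectors simultaneously. -/
theorem abs_tensorForm_le {T : ZMod n → ZMod n → ZMod n → ZMod n → ℝ} {τ : ℝ} (hτ : 0 ≤ τ)
    (hT : ∀ a b c d, |T a b c d| ≤ τ) (u₁ u₂ u₃ u₄ : Vec n) :
    |tensorForm T u₁ u₂ u₃ u₄| ≤ n ^ 2 * τ * (‖u₁‖ * ‖u₂‖ * ‖u₃‖ * ‖u₄‖) := by
  have h1 : |tensorForm T u₁ u₂ u₃ u₄| ≤
      ∑ a, ∑ b, ∑ c, ∑ d, τ * (|u₁ a| * |u₂ b| * |u₃ c| * |u₄ d|) := by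
    refine (Finset.abs_sum_le_sum_abs _ _).trans (Finset.sum_le_sum fun a _ => ?_)
    refine (Finset.abs_sum_le_sum_abs _ _).trans (Finset.sum_le_sum fun b _ => ?_)
    refine (Finset.abs_sum_le_sum_abs _ _).trans (Finset.sum_le_sum fun c _ => ?_)
    refine (Finset.abs_sum_le_sum_abs _ _).trans (Finset.sum_le_sum fun d _ => ?_)
    rw [abs_mul, abs_mul, abs_mul, abs_mul]
    exact mul_le_mul_of_nonneg_right (hT a b c d) (by positivity)
  have h2 : ∑ a, ∑ b, ∑ c, ∑ d, τ * (|u₁ a| * |u₂ b| * |u₃ c| * |u₄ d|) =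
      τ * ((∑ a, |u₁ a|) * (∑ b, |u₂ b|) * (∑ c, |u₃ c|) * (∑ d, |u₄ d|)) := by
    simp only [← Finset.mul_sum, ← Finset.sum_mul]
  have h3 : (√n : ℝ) ^ 4 = n ^ 2 := by
    rw [show 4 = 2 * 2 by norm_num, pow_mul, Real.sq_sqrt (Nat.cast_nonneg n)]
  rw [h2] at h1
  refine h1.trans ?_
  calc τ * ((∑ a, |u₁ a|) * (∑ b, |u₂ b|) * (∑ c, |u₃ c|) * (∑ d, |u₄ d|))
      ≤ τ * ((√n * ‖u₁‖) * (√n * ‖u₂‖) * (√n * ‖u₃‖) * (√n * ‖u₄‖)) := by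
        gcongr <;> exact sum_abs_le_sqrt_mul_norm _
    _ = √n ^ 4 * τ * (‖u₁‖ * ‖u₂‖ * ‖u₃‖ * ‖u₄‖) := by ring
    _ = _ := by rw [h3]

theorem tensorForm_sub (T T' : ZMod n → ZMod n → ZMod n → ZMod n → ℝ) (u₁ u₂ u₃ u₄ : Vec n) :
    tensorForm (fun a b c d => T a b c d - T' a b c d) u₁ u₂ u₃ u₄ =
      tensorForm T u₁ u₂ u₃ u₄ - tensorForm T' u₁ u₂ u₃ u₄ := by
  simp only [tensorForm, sub_mul, Finset.sum_sub_distrib]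

/-- The empirical fourth moment tensor of the rows of `C_{xᵢ}`. -/
def empiricalTensor {N : ℕ} (x : Fin N → Vec n) (a b c d : ZMod n) : ℝ :=
  (1 / (N : ℝ)) * ∑ i, ∑ k, x i (k - a) * x i (k - b) * x i (k - c) * x i (k - d)

/-- The expected fourth moment tensor. -/
def popTensor (θ : ℝ) (a b c d : ZMod n) : ℝ :=
  n * (θ * (1 - 3 * θ) * (if a = b ∧ a = c ∧ a = d then 1 else 0)
    + θ ^ 2 * ((if a = b then 1 else 0) * (if c = d then 1 else 0)
      + (if a = c then 1 else 0) * (if b = d then 1 else 0)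
      + (if a = d then 1 else 0) * (if b = c then 1 else 0)))

/-- The empirical second moment tensor of the rows of `C_{xᵢ}`. -/
def empiricalCov {N : ℕ} (x : Fin N → Vec n) (a b : ZMod n) : ℝ :=
  (1 / (N : ℝ)) * ∑ i, ∑ k, x i (k - a) * x i (k - b)

theorem popForm_eq_tensorForm (θ : ℝ) (u₁ u₂ u₃ u₄ : Vec n) :
    popForm θ u₁ u₂ u₃ u₄ = tensorForm (popTensor θ) u₁ u₂ u₃ u₄ := by
  have e0 : ∑ a, ∑ b, ∑ c, ∑ d, (if a = b ∧ a = c ∧ a = d then (1 : ℝ) else 0) *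
      (u₁ a * u₂ b * u₃ c * u₄ d) = ∑ j, u₁ j * u₂ j * u₃ j * u₄ j := by
    refine Finset.sum_congr rfl fun a _ => ?_
    simp [ite_and, Finset.sum_ite_eq]
  have e1 : ∑ a, ∑ b, ∑ c, ∑ d, ((if a = b then (1 : ℝ) else 0) * (if c = d then 1 else 0)) *
      (u₁ a * u₂ b * u₃ c * u₄ d) = inner ℝ u₁ u₂ * inner ℝ u₃ u₄ := by
    rw [inner_eq_sum, inner_eq_sum, Finset.sum_mul_sum]
    refine Finset.sum_congr rfl fun a _ => ?_
    simp [mul_assoc]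
  have e2 : ∑ a, ∑ b, ∑ c, ∑ d, ((if a = c then (1 : ℝ) else 0) * (if b = d then 1 else 0)) *
      (u₁ a * u₂ b * u₃ c * u₄ d) = inner ℝ u₁ u₃ * inner ℝ u₂ u₄ := by
    rw [inner_eq_sum, inner_eq_sum, Finset.sum_mul_sum]
    refine Finset.sum_congr rfl fun a _ => Finset.sum_congr rfl fun b _ => ?_
    simp [mul_assoc]
    left; ring
  have e3 : ∑ a, ∑ b, ∑ c, ∑ d, ((if a = d then (1 : ℝ) else 0) * (if b = c then 1 else 0)) *
      (u₁ a * u₂ b * u₃ c * u₄ d) = inner ℝ u₁ u₄ * inner ℝ u₂ u₃ := by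
    rw [inner_eq_sum, inner_eq_sum, Finset.sum_mul_sum]
    refine Finset.sum_congr rfl fun a _ => Finset.sum_congr rfl fun b _ => ?_
    simp [mul_assoc]
    left; ring
  have hT : ∀ a b c d, popTensor θ a b c d * (u₁ a * u₂ b * u₃ c * u₄ d) =
      n * (θ * (1 - 3 * θ)) * ((if a = b ∧ a = c ∧ a = d then (1 : ℝ) else 0) *
        (u₁ a * u₂ b * u₃ c * u₄ d))
      + n * θ ^ 2 * (((if a = b then (1 : ℝ) else 0) * (if c = d then 1 else 0)) *
        (u₁ a * u₂ b * u₃ c * u₄ d))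
      + n * θ ^ 2 * (((if a = c then (1 : ℝ) else 0) * (if b = d then 1 else 0)) *
        (u₁ a * u₂ b * u₃ c * u₄ d))
      + n * θ ^ 2 * (((if a = d then (1 : ℝ) else 0) * (if b = c then 1 else 0)) *
        (u₁ a * u₂ b * u₃ c * u₄ d)) := fun a b c d => by rw [popTensor]; ring
  simp only [tensorForm, hT, Finset.sum_add_distrib, ← Finset.mul_sum, e0, e1, e2, e3, popForm]
  ring

/-- The rows of the circulant matrices `C_{xᵢ}`. -/
def circRow {N : ℕ} (x : Fin N → Vec n) (p : Fin N × ZMod n) : Vec n :=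
  WithLp.toLp 2 fun j => x p.1 (p.2 - j)

theorem inner_circRow {N : ℕ} (x : Fin N → Vec n) (i : Fin N) (k : ZMod n) (u : Vec n) :
    inner ℝ (circRow x (i, k)) u = act (circ (x i)) u k := by
  rw [inner_eq_sum]; rfl

theorem quarticForm_circRow {N : ℕ} (x : Fin N → Vec n) (u₁ u₂ u₃ u₄ : Vec n) :
    quarticForm (1 / N) (circRow x) u₁ u₂ u₃ u₄ = tensorForm (empiricalTensor x) u₁ u₂ u₃ u₄ := by
  have h1 : ∀ p, inner ℝ (circRow x p) u₁ * inner ℝ (circRow x p) u₂ * inner ℝ (circRow x p) u₃ *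
      inner ℝ (circRow x p) u₄ = ∑ a, ∑ b, ∑ c, ∑ d, (x p.1 (p.2 - a) * x p.1 (p.2 - b) *
        x p.1 (p.2 - c) * x p.1 (p.2 - d)) * (u₁ a * u₂ b * u₃ c * u₄ d) := by
    intro p
    have h2 : ∀ a b c d, (x p.1 (p.2 - a) * x p.1 (p.2 - b) * x p.1 (p.2 - c) *
        x p.1 (p.2 - d)) * (u₁ a * u₂ b * u₃ c * u₄ d) = (x p.1 (p.2 - a) * u₁ a) *
        (x p.1 (p.2 - b) * u₂ b) * (x p.1 (p.2 - c) * u₃ c) * (x p.1 (p.2 - d) * u₄ d) :=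
      fun a b c d => by ring
    simp only [h2, ← Finset.mul_sum, ← Finset.sum_mul, inner_eq_sum, circRow]
  rw [quarticForm, Finset.sum_congr rfl fun p _ => h1 p, tensorForm, Finset.sum_comm,
    Finset.mul_sum]
  refine Finset.sum_congr rfl fun a _ => ?_
  rw [Finset.sum_comm, Finset.mul_sum]
  refine Finset.sum_congr rfl fun b _ => ?_
  rw [Finset.sum_comm, Finset.mul_sum]
  refine Finset.sum_congr rfl fun c _ => ?_
  rw [Finset.sum_comm, Finset.mul_sum]
  refine Finset.sum_congr rfl fun d _ => ?_
  rw [empiricalTensor, ← Fintype.sum_prod_type', mul_assoc (1 / (N : ℝ)), Finset.sum_mul]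

theorem gramMatrix_apply {N : ℕ} (θ : ℝ) (x : Fin N → Vec n) (a b : ZMod n) :
    gramMatrix θ x a b = empiricalCov x a b / (θ * n) := by
  simp only [gramMatrix, empiricalCov, Matrix.smul_apply, Matrix.sum_apply, Matrix.mul_apply,
    Matrix.transpose_apply, circ, Matrix.circulant_apply, smul_eq_mul]
  rw [one_div, mul_inv]
  ring

/-- Since $C_{y_i}=C_{x_i}C_f$, the common factor $C_fR$ moves to the rows of $C_{x_i}$ as its
transpose, which exhibits the objective as a `quartic`. -/
theorem objective_circConv {N : ℕ} (θ : ℝ) (x : Fin N → Vec n) (f : Vec n) :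
    objective θ (fun i => circConv (x i) f) = quartic (1 / N) (fun p =>
      act (circ f * preconditioner θ fun i => circConv (x i) f).transpose (circRow x p)) := by
  funext h
  simp only [objective, quartic, inner_act, Matrix.transpose_transpose, phi, circ_circConv, act_mul,
    Fintype.sum_prod_type, inner_circRow, ← Finset.mul_sum]
  ring

theorem quarticForm_act {ι : Type*} [Fintype ι] (w : ℝ) (a : ι → Vec n)
    (B : Matrix (ZMod n) (ZMod n) ℝ) (u₁ u₂ u₃ u₄ : Vec n) :
    quarticForm w (fun p => act B.transpose (a p)) u₁ u₂ u₃ u₄ =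
      quarticForm w a (act B u₁) (act B u₂) (act B u₃) (act B u₄) := by
  simp only [quarticForm, inner_act, Matrix.transpose_transpose]

/-- If the empirical moments are close to their expectations, then the preconditioner nearly
orthogonalizes the filter, and the rotated objective is close to the population objective. -/
theorem objective_near_population {N : ℕ} {θ ρ : ℝ} (h3 : θ < 1 / 3) (hn4 : 4 ≤ n)
    (hθn : 1 / (n : ℝ) ≤ θ) (hρ0 : 0 < ρ) (hρ : ρ < 1 / 1000) {x : Fin N → Vec n} {f : Vec n}
    (hf : ConvInvertible f)
    (hT : ∀ a b c d, |empiricalTensor x a b c d - popTensor θ a b c d| ≤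
      θ * (1 - 3 * θ) * ρ ^ 2 / (64 * n ^ 3))
    (hC : ∀ a b, |empiricalCov x a b - n * θ * (if a = b then 1 else 0)| ≤
      θ * (1 - 3 * θ) * ρ ^ 2 / (64 * n ^ 3)) :
    (gramMatrix θ fun i => circConv (x i) f).PosDef ∧
    (∀ u, ‖act (circ f) (act (preconditioner θ fun i => circConv (x i) f) (act (rotation f) u)) - u‖
      ≤ √ρ / 2 * ‖u‖) ∧
    ∃ a : Fin N × ZMod n → Vec n,
      objective θ (fun i => circConv (x i) f) = quartic (1 / N) a ∧
      ∀ u₁ u₂ u₃ u₄, |quarticForm (1 / N) a (act (rotation f) u₁) (act (rotation f) u₂)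
          (act (rotation f) u₃) (act (rotation f) u₄) - popForm θ u₁ u₂ u₃ u₄| ≤
        gap n θ ρ * (‖u₁‖ * ‖u₂‖ * ‖u₃‖ * ‖u₄‖) := by
  have hn4' : (4 : ℝ) ≤ n := by exact_mod_cast hn4
  have hn0 : (0 : ℝ) < n := by linarith
  have hθ0 : 0 < θ := lt_of_lt_of_le (by positivity) hθn
  have hθn' : 1 ≤ θ * n := by rwa [div_le_iff₀ hn0] at hθn
  have hβ : 0 < θ * (1 - 3 * θ) := mul_pos hθ0 (by linarith)
  have hβ1 : θ * (1 - 3 * θ) ≤ 1 := by nlinarith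
  set β := θ * (1 - 3 * θ) with hβdef
  set τ := β * ρ ^ 2 / (64 * n ^ 3) with hτ
  have hτ0 : 0 < τ := by positivity
  have hnτ : n * τ = β * ρ ^ 2 / (64 * n ^ 2) := by rw [hτ]; field_simp
  have hρ2 : β * ρ ^ 2 / (64 * n ^ 2) ≤ ρ / 64 := by
    rw [div_le_div_iff₀ (by positivity) (by norm_num)]
    have h1 : (1 : ℝ) ≤ n ^ 2 := by nlinarith
    have h2 : β * ρ ^ 2 ≤ ρ := by nlinarith
    nlinarith
  -- The normalization divides the covariance error by $\theta n\ge1$.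
  have hD : ∀ a b, |gramMatrix θ x a b - if a = b then 1 else 0| ≤ τ := by
    intro a b
    have e1 : gramMatrix θ x a b - (if a = b then 1 else 0) =
        (empiricalCov x a b - n * θ * (if a = b then 1 else 0)) / (θ * n) := by
      rw [gramMatrix_apply]; field_simp
    rw [e1, abs_div, abs_of_pos (by positivity : 0 < θ * n)]
    exact (div_le_self (abs_nonneg _) hθn').trans (hC a b)
  have hDpos := posDef_of_near_one (transpose_gramMatrix θ x) hτ0.le (by linarith) hD
  obtain ⟨hM, hMD⟩ := circ_mul_preconditioner_mul_rotation hf hDpos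
  have hM1 := norm_act_invSqrt_sub_self_le hM hMD hτ0.le (by linarith) hD
  set M := circ f * preconditioner θ (fun i => circConv (x i) f) * rotation f with hMdef
  refine ⟨posDef_gramMatrix_circConv hf hDpos, fun u => ?_, _, objective_circConv θ x f, ?_⟩
  · rw [← act_mul, ← act_mul]
    refine (hM1 u).trans ?_
    gcongr
    have : ρ ≤ √ρ := by
      rw [Real.le_sqrt hρ0.le hρ0.le]; nlinarith
    linarith
  · intro u₁ u₂ u₃ u₄
    rw [quarticForm_act]
    simp only [← act_mul, ← hMdef]
    rw [quarticForm_circRow]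
    have hM2 : ∀ u, ‖act M u‖ ≤ 2 * ‖u‖ := by
      intro u
      have h1 := norm_le_norm_sub_add (act M u) u
      have h2 := hM1 u
      nlinarith [norm_nonneg u]
    have e1 := abs_tensorForm_le hτ0.le hT (act M u₁) (act M u₂) (act M u₃) (act M u₄)
    rw [tensorForm_sub, ← popForm_eq_tensorForm] at e1
    have e2 := abs_popForm_map_sub_le hθ0.le h3.le (ε := 2 * (n * τ)) (by positivity)
      (by linarith) hM1 u₁ u₂ u₃ u₄
    have e3 : ‖act M u₁‖ * ‖act M u₂‖ * ‖act M u₃‖ * ‖act M u₄‖ ≤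
        16 * (‖u₁‖ * ‖u₂‖ * ‖u₃‖ * ‖u₄‖) := by
      calc _ ≤ (2 * ‖u₁‖) * (2 * ‖u₂‖) * (2 * ‖u₃‖) * (2 * ‖u₄‖) := by
            gcongr <;> exact hM2 _
        _ = _ := by ring
    set X := ‖u₁‖ * ‖u₂‖ * ‖u₃‖ * ‖u₄‖ with hX
    have hX0 : 0 ≤ X := by positivity
    have e4 := e1.trans (mul_le_mul_of_nonneg_left e3 (by positivity))
    have e5 := (abs_sub_le _ _ _).trans (add_le_add e4 e2)
    refine e5.trans ?_
    -- The first term is the moment error at $Mu_1,\dots,Mu_4$, whose norms at most double; the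
    -- second is the effect of $M$ on the population form. As $16+30\theta<32$ and $32n^2\tau$ is
    -- `gap n θ ρ`, the total fits.
    have e6 : n ^ 2 * τ * (16 * X) + 15 * (n * θ) * (2 * (n * τ)) * X
        = (16 + 30 * θ) * (n ^ 2 * τ) * X := by ring
    rw [e6]
    refine mul_le_mul_of_nonneg_right ?_ hX0
    have e7 : (n : ℝ) ^ 2 * τ = β * ρ ^ 2 / (2 * n) / 32 := by rw [hτ]; field_simp; norm_num
    rw [gap, e7, ← hβdef]
    have : 0 < β * ρ ^ 2 / (2 * n) := by positivity
    nlinarith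

variable {ι : Type*} [Fintype ι]

/-- Strong convexity near the signed shifted ground truth is inherited from the population. -/
theorem gap_le_curvature {θ ρ : ℝ} (hβ : 0 < θ * (1 - 3 * θ)) (hρ0 : 0 < ρ) (hρ : ρ < 1 / 1000)
    (hn4 : 4 ≤ n) {U : Matrix (ZMod n) (ZMod n) ℝ} (hU : U.transpose * U = 1) {w : ℝ}
    {a : ι → Vec n} (ha : ∀ u₁ u₂ u₃ u₄, |quarticForm w a (act U u₁) (act U u₂) (act U u₃)
      (act U u₄) - popForm θ u₁ u₂ u₃ u₄| ≤ gap n θ ρ * (‖u₁‖ * ‖u₂‖ * ‖u₃‖ * ‖u₄‖))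
    {S : Finset (ZMod n)} {h : Vec n} (hS : S.card = 1) (hn : NearFlat ρ S h)
    {z : Vec n} (hz1 : ‖z‖ = 1) (hz : inner ℝ z (act U h) = 0) :
    gap n θ ρ ≤ inner ℝ z (riemHess (quartic w a) (act U h) z) := by
  have hn4' : (4 : ℝ) ≤ n := by exact_mod_cast hn4
  rw [curvature_quartic w a hz hz1]
  obtain ⟨z, rfl⟩ := (act_bijective_of_orthogonal hU).2 z
  rw [norm_act_of_orthogonal hU] at hz1
  rw [inner_act_act_of_orthogonal hU] at hz
  have h1 := popForm_curvature_of_singleton hβ hρ0 hρ hS hn hz1 hz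
  have h2 := ha h h h h
  have h3 := ha h h z z
  rw [hn.1] at h2 h3
  rw [hz1] at h3
  have h2 := (abs_le.1 h2).1
  have h3 := (abs_le.1 h3).2
  -- The form enters the curvature with weights $1$ and $3$: four gaps are lost and one must remain.
  have h4 : 5 * gap n θ ρ ≤ n * (θ * (1 - 3 * θ)) / 2 := by
    rw [gap, ← mul_div_assoc, div_le_div_iff₀ (by positivity) (by norm_num)]
    have : 5 * ρ ^ 2 * 2 ≤ n * (2 * n) := by nlinarith
    calc 5 * (θ * (1 - 3 * θ) * ρ ^ 2) * 2 = θ * (1 - 3 * θ) * (5 * ρ ^ 2 * 2) := by ring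
      _ ≤ θ * (1 - 3 * θ) * (n * (2 * n)) := by gcongr
      _ = _ := by ring
  linarith

/-- Negative curvature near the saddle points is inherited from the population. -/
theorem exists_curvature_le_neg_gap {θ ρ : ℝ} (hβ : 0 < θ * (1 - 3 * θ)) (hρ0 : 0 < ρ)
    (hρ : ρ < 1 / 1000)
    (hn4 : 4 ≤ n) {U : Matrix (ZMod n) (ZMod n) ℝ} (hU : U.transpose * U = 1) {w : ℝ}
    {a : ι → Vec n} (ha : ∀ u₁ u₂ u₃ u₄, |quarticForm w a (act U u₁) (act U u₂) (act U u₃)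
      (act U u₄) - popForm θ u₁ u₂ u₃ u₄| ≤ gap n θ ρ * (‖u₁‖ * ‖u₂‖ * ‖u₃‖ * ‖u₄‖))
    {S : Finset (ZMod n)} {h : Vec n} (hS : 1 < S.card) (hn : NearFlat ρ S h) :
    ∃ z : Vec n, ‖z‖ = 1 ∧ inner ℝ z (act U h) = 0 ∧
      inner ℝ z (riemHess (quartic w a) (act U h) z) ≤ -gap n θ ρ := by
  have hn4' : (4 : ℝ) ≤ n := by exact_mod_cast hn4
  obtain ⟨z, hz1, hz, h1⟩ := exists_popForm_curvature_neg hβ hρ0 hρ hS hn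
  have hUz1 : ‖act U z‖ = 1 := by rwa [norm_act_of_orthogonal hU]
  have hUz : inner ℝ (act U z) (act U h) = 0 := by rwa [inner_act_act_of_orthogonal hU]
  refine ⟨act U z, hUz1, hUz, ?_⟩
  rw [curvature_quartic w a hUz hUz1]
  have h2 := ha h h h h
  have h3 := ha h h z z
  rw [hn.1] at h2 h3
  rw [hz1] at h3
  have h2 := (abs_le.1 h2).2
  have h3 := (abs_le.1 h3).1
  have h4 : 5 * gap n θ ρ ≤ θ * (1 - 3 * θ) := by
    rw [gap, ← mul_div_assoc, div_le_iff₀ (by positivity)]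
    have : 5 * ρ ^ 2 ≤ 2 * n := by nlinarith
    calc 5 * (θ * (1 - 3 * θ) * ρ ^ 2) = θ * (1 - 3 * θ) * (5 * ρ ^ 2) := by ring
      _ ≤ θ * (1 - 3 * θ) * (2 * n) := by gcongr
  linarith

/-- The large gradient away from the stationary points is inherited from the population. -/
theorem gap_le_norm_riemGrad {θ ρ : ℝ} (hβ : 0 < θ * (1 - 3 * θ)) (hρ0 : 0 < ρ)
    (hρ : ρ < 1 / 1000)
    (hn4 : 4 ≤ n) {U : Matrix (ZMod n) (ZMod n) ℝ} (hU : U.transpose * U = 1) {w : ℝ}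
    {a : ι → Vec n} (ha : ∀ u₁ u₂ u₃ u₄, |quarticForm w a (act U u₁) (act U u₂) (act U u₃)
      (act U u₄) - popForm θ u₁ u₂ u₃ u₄| ≤ gap n θ ρ * (‖u₁‖ * ‖u₂‖ * ‖u₃‖ * ‖u₄‖))
    {h : Vec n} (hh : ‖h‖ = 1) (hfar : ∀ S : Finset (ZMod n), ¬ NearFlat ρ S h) :
    gap n θ ρ ≤ ‖riemGrad (quartic w a) (act U h)‖ := by
  obtain ⟨z, hz1, hz, h1⟩ := exists_popForm_slope hβ hρ0 hρ hn4 hh hfar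
  have hUz : inner ℝ (act U z) (act U h) = 0 := by rwa [inner_act_act_of_orthogonal hU]
  have h2 := ha h h h z
  rw [hh, hz1] at h2
  have h2 := (abs_le.1 h2).1
  have h3 := inner_riemGrad_quartic w a hUz
  have h4 := abs_real_inner_le_norm (riemGrad (quartic w a) (act U h)) (act U z)
  rw [norm_act_of_orthogonal hU, hz1, mul_one] at h4
  have h4 := (abs_le.1 h4).1
  -- The slope involves a single value of the form, so one of two gaps survives.
  have h5 : θ * (1 - 3 * θ) * ρ ^ 2 / n = 2 * gap n θ ρ := by
    have : (n : ℝ) ≠ 0 := Nat.cast_ne_zero.2 (NeZero.ne n)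
    rw [gap]; field_simp
  linarith

end Landscape

/-! ### Independence, Hoeffding's inequality and moments of Bernoulli–Rademacher entries. -/

section Probability

variable {Ω : Type*} [MeasurableSpace Ω] {P : Measure Ω}

/-- Grouping a doubly indexed independent family by its first index. -/
theorem iIndepFun_curry {ι κ : Type*} {X : ι × κ → Ω → ℝ}
    (mX : ∀ p, Measurable (X p)) (h : iIndepFun X P) :
    iIndepFun (fun i ω (j : κ) => X (i, j) ω) P := by
  have hP := h.isProbabilityMeasure
  have : ∀ i j, IsProbabilityMeasure (P.map (X (i, j))) :=
    fun i j => Measure.isProbabilityMeasure_map (mX (i, j)).aemeasurable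
  rw [iIndepFun_iff_map_fun_eq_infinitePi_map (by fun_prop)]
  have h1 := (iIndepFun_iff_map_fun_eq_infinitePi_map mX).1 h
  have h2 : ∀ i, iIndepFun (fun j => X (i, j)) P := fun i =>
    h.precomp (g := fun j => (i, j)) fun a b hab => by simpa using hab
  have h3 : ∀ i, P.map (fun ω (j : κ) => X (i, j) ω) =
      Measure.infinitePi fun j => P.map (X (i, j)) := fun i =>
    (iIndepFun_iff_map_fun_eq_infinitePi_map fun j => mX (i, j)).1 (h2 i)
  simp only [h3]
  -- Independence means that the joint law is a product measure, and currying a product over pairs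
  -- gives a product of products.
  rw [← Measure.infinitePi_map_curry (fun i j => P.map (X (i, j))), ← h1,
    Measure.map_map (by fun_prop) (by fun_prop)]
  rfl

/-- Hoeffding's inequality for averages of bounded independent variables with common mean. -/
theorem measure_abs_average_sub_le [IsProbabilityMeasure P] {N : ℕ} (hN : 0 < N)
    {Z : Fin N → Ω → ℝ} (hind : iIndepFun Z P) (hm : ∀ i, Measurable (Z i)) {K : ℝ} (hK : 0 < K)
    (hb : ∀ i, ∀ᵐ ω ∂P, |Z i ω| ≤ K) {μ : ℝ} (hμ : ∀ i, ∫ ω, Z i ω ∂P = μ) {τ : ℝ} (hτ : 0 ≤ τ) :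
    P.real {ω | τ < |(1 / (N : ℝ)) * ∑ i, Z i ω - μ|} ≤
      2 * Real.exp (-(N * τ ^ 2) / (2 * K ^ 2)) := by
  have hN' : (0 : ℝ) < N := by exact_mod_cast hN
  -- Hoeffding's lemma on $[-K,K]$; the variance proxy is $K^2$.
  have hsub : ∀ i, HasSubgaussianMGF (fun ω => Z i ω - μ) ((‖K - -K‖₊ / 2) ^ 2) P := by
    intro i
    have := hasSubgaussianMGF_of_mem_Icc (hm i).aemeasurable (a := -K) (b := K) (by
      filter_upwards [hb i] with ω hω using abs_le.1 hω)
    rwa [hμ i] at this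
  have hc : ((∑ _i : Fin N, (‖K - -K‖₊ / 2) ^ 2 : NNReal) : ℝ) = N * K ^ 2 := by
    have : |K + K| / 2 = K := by rw [abs_of_pos (by linarith)]; ring
    simp [this]
  have hexp : -(N * τ) ^ 2 / (2 * (N * K ^ 2)) = -(N * τ ^ 2) / (2 * K ^ 2) := by
    field_simp
  have hind1 : iIndepFun (fun i ω => Z i ω - μ) P :=
    hind.comp (fun _ z => z - μ) fun _ => by fun_prop
  have hind2 : iIndepFun (fun i ω => -(Z i ω - μ)) P :=
    hind.comp (fun _ z => -(z - μ)) fun _ => by fun_prop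
  have h1 := HasSubgaussianMGF.measure_sum_ge_le_of_iIndepFun hind1 (s := Finset.univ)
    (fun i _ => hsub i) (ε := N * τ) (by positivity)
  have h2 := HasSubgaussianMGF.measure_sum_ge_le_of_iIndepFun hind2 (s := Finset.univ)
    (fun i _ => (hsub i).neg) (ε := N * τ) (by positivity)
  rw [hc, hexp] at h1 h2
  have hsum : ∀ ω, ∑ i, (Z i ω - μ) = N * ((1 / (N : ℝ)) * ∑ i, Z i ω - μ) := by
    intro ω
    rw [Finset.sum_sub_distrib]; simp; field_simp
  calc P.real {ω | τ < |(1 / (N : ℝ)) * ∑ i, Z i ω - μ|}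
      ≤ P.real ({ω | N * τ ≤ ∑ i, (Z i ω - μ)} ∪ {ω | N * τ ≤ ∑ i, -(Z i ω - μ)}) := by
        refine measureReal_mono ?_
        intro ω hω
        have hω : τ < |(1 / (N : ℝ)) * ∑ i, Z i ω - μ| := hω
        rw [lt_abs] at hω
        simp only [Set.mem_union, Set.mem_ofPred_eq, Finset.sum_neg_distrib, hsum]
        rcases hω with hω | hω
        · left; gcongr
        · right; rw [← mul_neg]; gcongr
    _ ≤ _ := measureReal_union_le _ _
    _ ≤ _ := by linarith

section TwoPoint

variable [IsProbabilityMeasure P]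

theorem ae_eq_or_eq_of_measure_add {Y : Ω → ℝ} (hY : Measurable Y) {u v : ℝ} (huv : u ≠ v)
    (h : P {ω | Y ω = u} + P {ω | Y ω = v} = 1) : ∀ᵐ ω ∂P, Y ω = u ∨ Y ω = v := by
  have hm : ∀ c, MeasurableSet {ω | Y ω = c} := fun c => hY (measurableSet_singleton c)
  have hd : Disjoint {ω | Y ω = u} {ω | Y ω = v} := by
    rw [Set.disjoint_left]
    intro ω h1 h2
    exact huv (h1.symm.trans h2)
  have h1 : P ({ω | Y ω = u} ∪ {ω | Y ω = v}) = 1 := by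
    rw [measure_union hd (hm v), h]
  exact (prob_compl_eq_zero_iff ((hm u).union (hm v))).2 h1

theorem ae_sq_eq_one_of_rademacher {A : Ω → ℝ} (hA : Measurable A)
    (h : P {ω | A ω = 1} = 1 / 2 ∧ P {ω | A ω = -1} = 1 / 2) : ∀ᵐ ω ∂P, A ω = 1 ∨ A ω = -1 := by
  refine ae_eq_or_eq_of_measure_add hA (by norm_num) ?_
  rw [h.1, h.2]
  exact ENNReal.add_halves 1

theorem integral_rademacher {A : Ω → ℝ} (hA : Measurable A)
    (h : P {ω | A ω = 1} = 1 / 2 ∧ P {ω | A ω = -1} = 1 / 2) : ∫ ω, A ω ∂P = 0 := by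
  have hm : ∀ c, MeasurableSet {ω | A ω = c} := fun c => hA (measurableSet_singleton c)
  have h1 : A =ᵐ[P] fun ω => {ω | A ω = 1}.indicator (fun _ => (1 : ℝ)) ω
      - {ω | A ω = -1}.indicator (fun _ => (1 : ℝ)) ω := by
    filter_upwards [ae_sq_eq_one_of_rademacher hA h] with ω hω
    rcases hω with hω | hω <;> simp [Set.indicator, hω] <;> norm_num
  rw [integral_congr_ae h1, integral_sub, integral_indicator_const _ (hm 1),
    integral_indicator_const _ (hm (-1)), measureReal_def, measureReal_def, h.1, h.2, sub_self]
  · exact (integrable_const 1).indicator (hm 1)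
  · exact (integrable_const 1).indicator (hm (-1))

theorem ae_eq_of_bernoulli {B : Ω → ℝ} (hB : Measurable B) {θ : ℝ} (h0 : 0 ≤ θ) (h1 : θ ≤ 1)
    (h : P {ω | B ω = 1} = ENNReal.ofReal θ ∧ P {ω | B ω = 0} = ENNReal.ofReal (1 - θ)) :
    ∀ᵐ ω ∂P, B ω = 1 ∨ B ω = 0 := by
  refine ae_eq_or_eq_of_measure_add hB one_ne_zero ?_
  rw [h.1, h.2, ← ENNReal.ofReal_add h0 (by linarith)]
  simp

theorem integral_bernoulli {B : Ω → ℝ} (hB : Measurable B) {θ : ℝ} (h0 : 0 ≤ θ) (h1 : θ ≤ 1)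
    (h : P {ω | B ω = 1} = ENNReal.ofReal θ ∧ P {ω | B ω = 0} = ENNReal.ofReal (1 - θ)) :
    ∫ ω, B ω ∂P = θ := by
  have h2 : B =ᵐ[P] {ω | B ω = 1}.indicator (fun _ => (1 : ℝ)) := by
    filter_upwards [ae_eq_of_bernoulli hB h0 h1 h] with ω hω
    rcases hω with hω | hω <;> simp [Set.indicator, hω]
  have hm : MeasurableSet {ω | B ω = 1} := hB (measurableSet_singleton 1)
  rw [integral_congr_ae h2, integral_indicator_const _ hm,
    measureReal_def, h.1, ENNReal.toReal_ofReal h0]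
  simp

end TwoPoint

/-- The properties of the Bernoulli-Rademacher entries used below. -/
structure IsSparseFamily {J : Type*} (P : Measure Ω) (θ : ℝ) (ξ : J → Ω → ℝ) : Prop where
  measurable : ∀ p, Measurable (ξ p)
  indep : iIndepFun ξ P
  bounded : ∀ p, ∀ᵐ ω ∂P, |ξ p ω| ≤ 1
  mean : ∀ p, ∫ ω, ξ p ω ∂P = 0
  second : ∀ p, ∫ ω, ξ p ω ^ 2 ∂P = θ
  fourth : ∀ p, ∫ ω, ξ p ω ^ 4 ∂P = θ

/-- Almost surely $A^2=1$ and $B^2=B$, so every even power of an entry is $B$, with mean $\theta$;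
the mean of an entry vanishes with that of $A$. -/
theorem IsBernoulliRademacher.isSparseFamily [IsProbabilityMeasure P] {n : ℕ} [NeZero n] {N : ℕ}
    {θ : ℝ} (h0 : 0 ≤ θ) (h1 : θ ≤ 1) {x : Fin N → Ω → Vec n} (hx : IsBernoulliRademacher P θ x) :
    IsSparseFamily P θ (fun (p : Fin N × ZMod n) ω => x p.1 ω p.2) := by
  obtain ⟨A, B, mA, mB, hind, hA, hB, hxAB⟩ := hx
  have hξ : (fun (p : Fin N × ZMod n) ω => x p.1 ω p.2) = fun p ω => A p ω * B p ω := by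
    funext p ω; exact hxAB p.1 p.2 ω
  rw [hξ]
  have hAae := fun p => ae_sq_eq_one_of_rademacher (mA p) (hA p)
  have hBae := fun p => ae_eq_of_bernoulli (mB p) h0 h1 (hB p)
  have mX : ∀ k, Measurable (Sum.elim A B k) := by
    rintro (p | p)
    · exact mA p
    · exact mB p
  have hAB : ∀ p, IndepFun (A p) (B p) P := fun p =>
    hind.indepFun (i := Sum.inl p) (j := Sum.inr p) (by simp)
  refine ⟨fun p => (mA p).mul (mB p), ?_, fun p => ?_, fun p => ?_, fun p => ?_, fun p => ?_⟩
  -- Indexing by an entry and a Boolean lets `iIndepFun_curry` group `A p` with `B p`, so that their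
  -- products are independent over `p`.
  · have hpre := hind.precomp (g := fun q : (Fin N × ZMod n) × Bool =>
      if q.2 then Sum.inl q.1 else Sum.inr q.1) (by
        rintro ⟨p, b⟩ ⟨p', b'⟩ h
        cases b <;> cases b' <;> simp_all)
    have hcur := iIndepFun_curry (fun q => mX _) hpre
    have := hcur.comp (fun _ (v : Bool → ℝ) => v true * v false) fun _ => by fun_prop
    exact this
  · filter_upwards [hAae p, hBae p] with ω ha hb
    rcases ha with ha | ha <;> rcases hb with hb | hb <;> simp [ha, hb]
  · have := (hAB p).integral_mul_eq_mul_integral (mA p).aestronglyMeasurable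
      (mB p).aestronglyMeasurable
    rw [integral_rademacher (mA p) (hA p), zero_mul] at this
    exact this
  · rw [← integral_bernoulli (mB p) h0 h1 (hB p)]
    refine integral_congr_ae ?_
    filter_upwards [hAae p, hBae p] with ω ha hb
    rcases ha with ha | ha <;> rcases hb with hb | hb <;> simp [ha, hb]
  · rw [← integral_bernoulli (mB p) h0 h1 (hB p)]
    refine integral_congr_ae ?_
    filter_upwards [hAae p, hBae p] with ω ha hb
    rcases ha with ha | ha <;> rcases hb with hb | hb <;> simp [ha, hb]
    norm_num

namespace IsSparseFamily

variable {J : Type*} {θ : ℝ} {ξ : J → Ω → ℝ}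

theorem precomp {K : Type*} (h : IsSparseFamily P θ ξ) {g : K → J} (hg : Function.Injective g) :
    IsSparseFamily P θ (fun k => ξ (g k)) :=
  ⟨fun _ => h.measurable _, h.indep.precomp hg, fun _ => h.bounded _, fun _ => h.mean _,
    fun _ => h.second _, fun _ => h.fourth _⟩

theorem integral_mul_of_ne (h : IsSparseFamily P θ ξ) {a b : J} (hab : a ≠ b) :
    ∫ ω, ξ a ω * ξ b ω ∂P = 0 := by
  have := (h.indep.indepFun hab).integral_mul_eq_mul_integral
    (h.measurable a).aestronglyMeasurable (h.measurable b).aestronglyMeasurable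
  rw [h.mean a, zero_mul] at this
  exact this

theorem integral_mul [DecidableEq J] (h : IsSparseFamily P θ ξ) (a b : J) :
    ∫ ω, ξ a ω * ξ b ω ∂P = θ * if a = b then 1 else 0 := by
  split_ifs with hab
  · subst hab
    simp only [← sq, h.second, mul_one]
  · rw [h.integral_mul_of_ne hab, mul_zero]

/-- An index occurring only once splits off as an independent factor of mean zero. The other three
indices may coincide, so independence is used for finite sets of indices. -/
theorem integral_mul_eq_zero (h : IsSparseFamily P θ ξ) {a b c d : J} (hab : a ≠ b) (hac : a ≠ c)
    (had : a ≠ d) : ∫ ω, ξ a ω * (ξ b ω * ξ c ω * ξ d ω) ∂P = 0 := by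
  classical
  have hdis : Disjoint ({a} : Finset J) {b, c, d} := by
    simp [hab, hac, had]
  have h1 := h.indep.indepFun_finset {a} {b, c, d} hdis h.measurable
  have m1 : Measurable fun v : ({a} : Finset J) → ℝ => v ⟨a, by simp⟩ := measurable_pi_apply _
  have m2 : Measurable fun v : ({b, c, d} : Finset J) → ℝ =>
      v ⟨b, by simp⟩ * v ⟨c, by simp⟩ * v ⟨d, by simp⟩ := by fun_prop
  have h2 := h1.comp m1 m2
  have h3 := h2.integral_mul_eq_mul_integral (h.measurable a).aestronglyMeasurable
    (((h.measurable b).mul (h.measurable c)).mul (h.measurable d)).aestronglyMeasurable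
  have h4 : ∫ ω, ((fun v : ({a} : Finset J) → ℝ => v ⟨a, by simp⟩) ∘
      fun ω (i : ({a} : Finset J)) => ξ i ω) ω ∂P = 0 := h.mean a
  rw [h4, zero_mul] at h3
  exact h3

theorem integral_sq_mul_sq (h : IsSparseFamily P θ ξ) {a c : J} (hac : a ≠ c) :
    ∫ ω, ξ a ω ^ 2 * ξ c ω ^ 2 ∂P = θ ^ 2 := by
  have h1 := (h.indep.indepFun hac).comp (φ := fun t => t ^ 2) (ψ := fun t => t ^ 2)
    (by fun_prop) (by fun_prop)
  have h2 := h1.integral_mul_eq_mul_integral ((h.measurable a).pow_const 2).aestronglyMeasurable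
    ((h.measurable c).pow_const 2).aestronglyMeasurable
  have h3 : ∀ p, ∫ ω, ((fun t : ℝ => t ^ 2) ∘ ξ p) ω ∂P = θ := h.second
  rw [h3, h3] at h2
  rw [sq θ]
  exact h2

/-- The fourth moments of a Bernoulli-Rademacher family. -/
theorem integral_mul_mul_mul [DecidableEq J] (h : IsSparseFamily P θ ξ) (a b c d : J) :
    ∫ ω, ξ a ω * ξ b ω * ξ c ω * ξ d ω ∂P =
      θ * (1 - 3 * θ) * (if a = b ∧ a = c ∧ a = d then 1 else 0)
    + θ ^ 2 * ((if a = b then 1 else 0) * (if c = d then 1 else 0)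
      + (if a = c then 1 else 0) * (if b = d then 1 else 0)
      + (if a = d then 1 else 0) * (if b = c then 1 else 0)) := by
  -- Only two coincidence patterns have no isolated index: two distinct pairs, giving $\theta^2$,
  -- and all four equal, giving $\theta=\theta(1-3\theta)+3\theta^2$.
  have lone : ∀ a b c d : J, a ≠ b → a ≠ c → a ≠ d → ∀ F : Ω → ℝ,
      (∀ ω, F ω = ξ a ω * (ξ b ω * ξ c ω * ξ d ω)) → ∫ ω, F ω ∂P = 0 := by
    intro a b c d hab hac had F hF
    rw [funext hF]
    exact h.integral_mul_eq_zero hab hac had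
  have pair : ∀ a c : J, a ≠ c → ∀ F : Ω → ℝ,
      (∀ ω, F ω = ξ a ω ^ 2 * ξ c ω ^ 2) → ∫ ω, F ω ∂P = θ ^ 2 := by
    intro a c hac F hF
    rw [funext hF]
    exact h.integral_sq_mul_sq hac
  by_cases hab : a = b
  · subst hab
    by_cases hcd : c = d
    · subst hcd
      by_cases hac : a = c
      · subst hac
        have : ∀ ω, ξ a ω * ξ a ω * ξ a ω * ξ a ω = ξ a ω ^ 4 := fun ω => by ring
        simp only [this, h.fourth]
        simp; ring
      · rw [pair a c hac _ fun ω => by ring]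
        simp [hac]
    · by_cases hca : c = a
      · subst hca
        rw [lone d c c c (Ne.symm hcd) (Ne.symm hcd) (Ne.symm hcd) _ fun ω => by ring]
        simp [hcd]
      · rw [lone c a a d hca hca hcd _ fun ω => by ring]
        simp [hcd, Ne.symm hca]
  · by_cases hac : a = c
    · subst hac
      by_cases hbd : b = d
      · subst hbd
        rw [pair a b hab _ fun ω => by ring]
        simp [hab]
      · rw [lone b a a d (Ne.symm hab) (Ne.symm hab) hbd _ fun ω => by ring]
        simp [hab, hbd, Ne.symm hab]
    · by_cases had : a = d
      · subst had
        by_cases hbc : b = c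
        · subst hbc
          rw [pair a b hab _ fun ω => by ring]
          simp [hab]
        · rw [lone b a c a (Ne.symm hab) hbc (Ne.symm hab) _ fun ω => by ring]
          simp [hab, hbc, hac]
      · rw [lone a b c d hab hac had _ fun ω => by ring]
        simp [hab, hac, had]

end IsSparseFamily

end Probability

/-! ### Concentration of the empirical second and fourth moments. -/

section Concentration

variable {Ω : Type*} [MeasurableSpace Ω] {P : Measure Ω}
  {n : ℕ} [NeZero n] {N : ℕ} {θ : ℝ} {x : Fin N → Ω → Vec n}

theorem abs_sum_le_card {F : ZMod n → ℝ} (hF : ∀ k, |F k| ≤ 1) : |∑ k, F k| ≤ n := by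
  refine (Finset.abs_sum_le_sum_abs _ _).trans ((Finset.sum_le_sum fun k _ => hF k).trans ?_)
  simp

theorem integrable_of_ae_abs_le [IsFiniteMeasure P] {Z : Ω → ℝ} (hm : Measurable Z) {K : ℝ}
    (hb : ∀ᵐ ω ∂P, |Z ω| ≤ K) : Integrable Z P :=
  Integrable.of_bound hm.aestronglyMeasurable K hb

/-- The unnormalized fourth moments of the rows of `C_v`. -/
def rowMoment (a b c d : ZMod n) (v : ZMod n → ℝ) : ℝ :=
  ∑ k, v (k - a) * v (k - b) * v (k - c) * v (k - d)

/-- The unnormalized second moments of the rows of `C_v`. -/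
def rowCov (a b : ZMod n) (v : ZMod n → ℝ) : ℝ := ∑ k, v (k - a) * v (k - b)

theorem measurable_rowMoment (a b c d : ZMod n) : Measurable (rowMoment a b c d) := by
  unfold rowMoment; fun_prop

theorem measurable_rowCov (a b : ZMod n) : Measurable (rowCov a b) := by
  unfold rowCov; fun_prop

theorem abs_rowMoment_le {v : ZMod n → ℝ} (hv : ∀ j, |v j| ≤ 1) (a b c d : ZMod n) :
    |rowMoment a b c d v| ≤ n := by
  refine abs_sum_le_card fun k => ?_
  rw [abs_mul, abs_mul, abs_mul]
  exact mul_le_one₀ (mul_le_one₀ (mul_le_one₀ (hv _) (abs_nonneg _) (hv _)) (abs_nonneg _) (hv _))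
    (abs_nonneg _) (hv _)

theorem abs_rowCov_le {v : ZMod n → ℝ} (hv : ∀ j, |v j| ≤ 1) (a b : ZMod n) :
    |rowCov a b v| ≤ n := by
  refine abs_sum_le_card fun k => ?_
  rw [abs_mul]
  exact mul_le_one₀ (hv _) (abs_nonneg _) (hv _)

namespace IsSparseFamily

theorem measurable_row (h : IsSparseFamily P θ (fun (p : Fin N × ZMod n) ω => x p.1 ω p.2))
    (i : Fin N) : Measurable fun ω (j : ZMod n) => x i ω j :=
  measurable_pi_iff.2 fun j => h.measurable (i, j)

theorem ae_bounded (h : IsSparseFamily P θ (fun (p : Fin N × ZMod n) ω => x p.1 ω p.2))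
    (i : Fin N) : ∀ᵐ ω ∂P, ∀ j, |x i ω j| ≤ 1 :=
  ae_all_iff.2 fun j => h.bounded (i, j)

/-- The $n$ shifts of one sample are dependent, so concentration comes from independence across
samples: each sample contributes one bounded variable. -/
theorem iIndepFun_comp_row (h : IsSparseFamily P θ (fun (p : Fin N × ZMod n) ω => x p.1 ω p.2))
    {g : (ZMod n → ℝ) → ℝ} (hg : Measurable g) :
    iIndepFun (fun i ω => g fun j => x i ω j) P :=
  (iIndepFun_curry h.measurable h.indep).comp (fun _ => g) fun _ => hg

theorem measurable_empiricalTensor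
    (h : IsSparseFamily P θ (fun (p : Fin N × ZMod n) ω => x p.1 ω p.2)) (a b c d : ZMod n) :
    Measurable fun ω => empiricalTensor (fun i => x i ω) a b c d := by
  exact (Finset.measurable_fun_sum _ fun i _ =>
    (measurable_rowMoment a b c d).comp (h.measurable_row i)).const_mul _

theorem measurable_empiricalCov
    (h : IsSparseFamily P θ (fun (p : Fin N × ZMod n) ω => x p.1 ω p.2)) (a b : ZMod n) :
    Measurable fun ω => empiricalCov (fun i => x i ω) a b := by
  exact (Finset.measurable_fun_sum _ fun i _ =>
    (measurable_rowCov a b).comp (h.measurable_row i)).const_mul _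

variable [IsProbabilityMeasure P]

theorem integrable_rowMoment
    (h : IsSparseFamily P θ (fun (p : Fin N × ZMod n) ω => x p.1 ω p.2))
    (i : Fin N) (a b c d : ZMod n) :
    Integrable (fun ω => rowMoment a b c d fun j => x i ω j) P := by
  refine integrable_of_ae_abs_le ((measurable_rowMoment a b c d).comp (h.measurable_row i))
    (K := n) ?_
  filter_upwards [h.ae_bounded i] with ω hω
  exact abs_rowMoment_le hω a b c d

/-- Coincidences among $k-a,\dots,k-d$ are those among $a,\dots,d$, so all $n$ shifts have the same
mean. -/
theorem integral_rowMoment (h : IsSparseFamily P θ (fun (p : Fin N × ZMod n) ω => x p.1 ω p.2))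
    (i : Fin N) (a b c d : ZMod n) :
    ∫ ω, rowMoment a b c d (fun j => x i ω j) ∂P = popTensor θ a b c d := by
  have hi := h.precomp (g := fun j : ZMod n => (i, j)) fun a b hab => by simpa using hab
  simp only [rowMoment]
  rw [integral_finsetSum]
  · have : ∀ k, ∫ ω, x i ω (k - a) * x i ω (k - b) * x i ω (k - c) * x i ω (k - d) ∂P = _ :=
      fun k => hi.integral_mul_mul_mul (k - a) (k - b) (k - c) (k - d)
    simp only [this, sub_right_inj]
    rw [Finset.sum_const, Finset.card_univ, ZMod.card, nsmul_eq_mul, popTensor]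
  · intro k _
    have hx : ∀ j, Measurable fun ω => x i ω j := fun j => h.measurable (i, j)
    refine integrable_of_ae_abs_le ((((hx _).mul (hx _)).mul (hx _)).mul (hx _)) (K := 1) ?_
    filter_upwards [h.ae_bounded i] with ω hω
    rw [abs_mul, abs_mul, abs_mul]
    exact mul_le_one₀ (mul_le_one₀ (mul_le_one₀ (hω _) (abs_nonneg _) (hω _)) (abs_nonneg _)
      (hω _)) (abs_nonneg _) (hω _)

theorem integral_rowCov (h : IsSparseFamily P θ (fun (p : Fin N × ZMod n) ω => x p.1 ω p.2))
    (i : Fin N) (a b : ZMod n) :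
    ∫ ω, rowCov a b (fun j => x i ω j) ∂P = n * θ * if a = b then 1 else 0 := by
  have hi := h.precomp (g := fun j : ZMod n => (i, j)) fun a b hab => by simpa using hab
  simp only [rowCov]
  rw [integral_finsetSum]
  · have : ∀ k, ∫ ω, x i ω (k - a) * x i ω (k - b) ∂P = _ :=
      fun k => hi.integral_mul (k - a) (k - b)
    simp only [this, sub_right_inj]
    simp
  · intro k _
    have hx : ∀ j, Measurable fun ω => x i ω j := fun j => h.measurable (i, j)
    refine integrable_of_ae_abs_le ((hx _).mul (hx _)) (K := 1) ?_
    filter_upwards [h.ae_bounded i] with ω hω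
    rw [abs_mul]
    exact mul_le_one₀ (hω _) (abs_nonneg _) (hω _)

theorem measure_empiricalTensor_le
    (h : IsSparseFamily P θ (fun (p : Fin N × ZMod n) ω => x p.1 ω p.2)) (hN : 0 < N) {τ : ℝ}
    (hτ : 0 ≤ τ) (a b c d : ZMod n) :
    P.real {ω | τ < |empiricalTensor (fun i => x i ω) a b c d - popTensor θ a b c d|} ≤
      2 * Real.exp (-(N * τ ^ 2) / (2 * n ^ 2)) := by
  refine measure_abs_average_sub_le hN (h.iIndepFun_comp_row (measurable_rowMoment a b c d))
    (fun i => (measurable_rowMoment a b c d).comp (h.measurable_row i))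
    (Nat.cast_pos.2 (NeZero.pos n)) (fun i => ?_) (fun i => h.integral_rowMoment i a b c d) hτ
  filter_upwards [h.ae_bounded i] with ω hω using abs_rowMoment_le hω a b c d

theorem measure_empiricalCov_le
    (h : IsSparseFamily P θ (fun (p : Fin N × ZMod n) ω => x p.1 ω p.2)) (hN : 0 < N) {τ : ℝ}
    (hτ : 0 ≤ τ) (a b : ZMod n) :
    P.real {ω | τ < |empiricalCov (fun i => x i ω) a b - n * θ * (if a = b then 1 else 0)|} ≤
      2 * Real.exp (-(N * τ ^ 2) / (2 * n ^ 2)) := by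
  refine measure_abs_average_sub_le hN (h.iIndepFun_comp_row (measurable_rowCov a b))
    (fun i => (measurable_rowCov a b).comp (h.measurable_row i))
    (Nat.cast_pos.2 (NeZero.pos n)) (fun i => ?_) (fun i => h.integral_rowCov i a b) hτ
  filter_upwards [h.ae_bounded i] with ω hω using abs_rowCov_le hω a b

/-- With high probability all empirical moments are close to their expectations. -/
theorem exists_event_moments_close
    (h : IsSparseFamily P θ (fun (p : Fin N × ZMod n) ω => x p.1 ω p.2)) (hN : 0 < N) {τ : ℝ}
    (hτ : 0 ≤ τ) :
    ∃ E : Set Ω, MeasurableSet E ∧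
      1 - (n ^ 4 + n ^ 2) * (2 * Real.exp (-(N * τ ^ 2) / (2 * n ^ 2))) ≤ P.real E ∧
      ∀ ω ∈ E,
        (∀ a b c d, |empiricalTensor (fun i => x i ω) a b c d - popTensor θ a b c d| ≤ τ) ∧
        ∀ a b, |empiricalCov (fun i => x i ω) a b - n * θ * (if a = b then 1 else 0)| ≤ τ := by
  set e := 2 * Real.exp (-(N * τ ^ 2) / (2 * n ^ 2)) with he
  set B₁ : ZMod n × ZMod n × ZMod n × ZMod n → Set Ω := fun p =>
    {ω | τ < |empiricalTensor (fun i => x i ω) p.1 p.2.1 p.2.2.1 p.2.2.2 -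
      popTensor θ p.1 p.2.1 p.2.2.1 p.2.2.2|} with hB₁
  set B₂ : ZMod n × ZMod n → Set Ω := fun p =>
    {ω | τ < |empiricalCov (fun i => x i ω) p.1 p.2 - n * θ * (if p.1 = p.2 then 1 else 0)|}
    with hB₂
  have m1 : ∀ p, MeasurableSet (B₁ p) := fun p => by
    have := h.measurable_empiricalTensor p.1 p.2.1 p.2.2.1 p.2.2.2
    exact measurableSet_lt measurable_const (this.sub_const _).abs
  have m2 : ∀ p, MeasurableSet (B₂ p) := fun p => by
    have := h.measurable_empiricalCov p.1 p.2
    exact measurableSet_lt measurable_const (this.sub_const _).abs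
  have hmB : MeasurableSet ((⋃ p, B₁ p) ∪ ⋃ p, B₂ p) :=
    (MeasurableSet.iUnion m1).union (MeasurableSet.iUnion m2)
  refine ⟨((⋃ p, B₁ p) ∪ ⋃ p, B₂ p)ᶜ, hmB.compl, ?_, ?_⟩
  · rw [probReal_compl_eq_one_sub hmB]
    have u1 : P.real (⋃ p, B₁ p) ≤ n ^ 4 * e := by
      refine (measureReal_iUnion_fintype_le B₁).trans ?_
      refine (Finset.sum_le_sum fun p _ =>
        h.measure_empiricalTensor_le hN hτ p.1 p.2.1 p.2.2.1 p.2.2.2).trans ?_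
      rw [Finset.sum_const, Finset.card_univ]
      simp only [Fintype.card_prod, ZMod.card, nsmul_eq_mul, ← he]
      push_cast
      apply le_of_eq; ring
    have u2 : P.real (⋃ p, B₂ p) ≤ n ^ 2 * e := by
      refine (measureReal_iUnion_fintype_le B₂).trans ?_
      refine (Finset.sum_le_sum fun p _ => h.measure_empiricalCov_le hN hτ p.1 p.2).trans ?_
      rw [Finset.sum_const, Finset.card_univ]
      simp only [Fintype.card_prod, ZMod.card, nsmul_eq_mul, ← he]
      push_cast
      apply le_of_eq; ring
    have u3 := measureReal_union_le (μ := P) (⋃ p, B₁ p) (⋃ p, B₂ p)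
    linarith
  · intro ω hω
    simp only [Set.mem_compl_iff, Set.mem_union, Set.mem_iUnion, not_or, not_exists] at hω
    exact ⟨fun a b c d => not_lt.1 (hω.1 (a, b, c, d)), fun a b => not_lt.1 (hω.2 (a, b))⟩

theorem integral_empiricalTensor
    (h : IsSparseFamily P θ (fun (p : Fin N × ZMod n) ω => x p.1 ω p.2)) (hN : 0 < N)
    (a b c d : ZMod n) :
    Integrable (fun ω => empiricalTensor (fun i => x i ω) a b c d) P ∧
      ∫ ω, empiricalTensor (fun i => x i ω) a b c d ∂P = popTensor θ a b c d := by
  have hN' : (N : ℝ) ≠ 0 := by exact_mod_cast hN.ne'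
  have h1 : (fun ω => empiricalTensor (fun i => x i ω) a b c d) =
      fun ω => (1 / (N : ℝ)) * ∑ i, rowMoment a b c d fun j => x i ω j := rfl
  rw [h1]
  refine ⟨(integrable_finsetSum _ fun i _ => h.integrable_rowMoment i a b c d).const_mul _, ?_⟩
  rw [integral_const_mul, integral_finsetSum _ fun i _ => h.integrable_rowMoment i a b c d]
  simp only [h.integral_rowMoment]
  simp [hN']

/-- The expected objective is the population objective. -/
theorem expectedObjective_eq
    (h : IsSparseFamily P θ (fun (p : Fin N × ZMod n) ω => x p.1 ω p.2)) (hN : 0 < N) :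
    expectedObjective P x = popObjective θ := by
  funext u
  have h1 : ∀ ω, (1 / (N : ℝ)) * ∑ i, phi (act (circ (x i ω)) u) =
      -(1 / 4) * tensorForm (empiricalTensor fun i => x i ω) u u u u := by
    intro ω
    rw [← quarticForm_circRow, ← quartic_eq_form]
    simp only [quartic, Fintype.sum_prod_type, inner_circRow, phi, ← Finset.mul_sum]
    ring
  have hi := fun a b c d => (h.integral_empiricalTensor hN a b c d).1
  simp only [expectedObjective, h1, popObjective, popForm_eq_tensorForm]
  rw [integral_const_mul]
  congr 1
  simp only [tensorForm]
  rw [integral_finsetSum _ fun a _ => integrable_finsetSum _ fun b _ =>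
    integrable_finsetSum _ fun c _ => integrable_finsetSum _ fun d _ => (hi a b c d).mul_const _]
  refine Finset.sum_congr rfl fun a _ => ?_
  rw [integral_finsetSum _ fun b _ => integrable_finsetSum _ fun c _ =>
    integrable_finsetSum _ fun d _ => (hi a b c d).mul_const _]
  refine Finset.sum_congr rfl fun b _ => ?_
  rw [integral_finsetSum _ fun c _ => integrable_finsetSum _ fun d _ =>
    (hi a b c d).mul_const _]
  refine Finset.sum_congr rfl fun c _ => ?_
  rw [integral_finsetSum _ fun d _ => (hi a b c d).mul_const _]
  refine Finset.sum_congr rfl fun d _ => ?_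
  rw [integral_mul_const, (h.integral_empiricalTensor hN a b c d).2]

end IsSparseFamily

end Concentration

/-! ### The three regions in terms of flat vectors. -/

section Regions

variable {n : ℕ} [NeZero n]

theorem inner_single_one (h : Vec n) (j : ZMod n) :
    inner ℝ h (EuclideanSpace.single j (1 : ℝ)) = h j := by
  rw [inner_eq_sum]
  simp

/-- Makes the set of tangent curvatures nonempty, so that its minimum exists. The projection of
$e_k$ has $k$-th entry $1-h_k^2$, and these entries cannot all vanish for $n\ge2$. -/
theorem exists_unit_tangent (hn : 2 ≤ n) {h : Vec n} (hh : ‖h‖ = 1) :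
    ∃ z : Vec n, ‖z‖ = 1 ∧ inner ℝ z h = 0 := by
  classical
  have : Nontrivial (ZMod n) := by
    rw [← Fintype.one_lt_card_iff_nontrivial, ZMod.card]; omega
  obtain ⟨k, hk⟩ : ∃ k, h k ^ 2 ≠ 1 := by
    by_contra! hall
    have hs := norm_sq_eq_sum h
    rw [hh] at hs
    simp only [hall, Finset.sum_const, Finset.card_univ, ZMod.card, nsmul_eq_mul, mul_one,
      one_pow] at hs
    have : n = 1 := by exact_mod_cast hs.symm
    omega
  set g := tangentProj h (EuclideanSpace.single k 1) with hg
  have hgk : g k = 1 - h k ^ 2 := by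
    rw [hg, tangentProj_apply, inner_single_one]
    simp
    ring
  have hg0 : g ≠ 0 := by
    intro h0
    rw [h0] at hgk
    exact hk (by simp at hgk; linarith)
  refine ⟨‖g‖⁻¹ • g, ?_, ?_⟩
  · rw [norm_smul, norm_inv, norm_norm, inv_mul_cancel₀ (norm_ne_zero_iff.2 hg0)]
  · rw [inner_smul_left, inner_tangentProj_self hh, mul_zero]

/-- One squared entry is at least $1-\rho$, while near a larger support every squared entry is at
most $(1+\rho)/2$. -/
theorem not_nearFlat_of_singleton {ρ : ℝ} (hρ0 : 0 < ρ) (hρ : ρ < 1 / 1000)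
    {S S' : Finset (ZMod n)} {h : Vec n} (hS : S.card = 1) (hn : NearFlat ρ S h)
    (hS' : 1 < S'.card) : ¬ NearFlat ρ S' h := by
  rintro ⟨-, -, h1, h2⟩
  obtain ⟨i, hi, -⟩ := nearFlat_singleton hS hn
  have hr : (2 : ℝ) ≤ S'.card := by exact_mod_cast hS'
  have hρr : ρ / S'.card ≤ ρ / 2 := by gcongr
  have hr1 : 1 / (S'.card : ℝ) ≤ 1 / 2 := by gcongr
  by_cases hj : i ∈ S'
  · have := (abs_le.1 (h1 i hj)).2
    linarith
  · have := h2 i hj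
    linarith

/-- With the right sign the squared distance is $2-2|h_j|\le2\rho$. The constant $\frac32$ leaves
$\frac12\sqrt\rho$ for the error of the preconditioner. -/
theorem nearFlat_singleton_close {ρ : ℝ} (hρ0 : 0 < ρ) (hρ : ρ < 1 / 1000)
    {S : Finset (ZMod n)} {h : Vec n} (hS : S.card = 1) (hn : NearFlat ρ S h) :
    ∃ j, ‖h - EuclideanSpace.single j 1‖ ≤ 3 / 2 * √ρ ∨
      ‖h + EuclideanSpace.single j 1‖ ≤ 3 / 2 * √ρ := by
  obtain ⟨j, hj, -⟩ := nearFlat_singleton hS hn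
  have hj1 : |h j| ≤ 1 := hn.1 ▸ abs_coord_le_norm h j
  have hj2 : 1 - ρ ≤ |h j| := by
    rw [← sq_abs] at hj
    nlinarith [abs_nonneg (h j)]
  have hsq : √ρ ^ 2 = ρ := Real.sq_sqrt hρ0.le
  have hs1 : ‖h - EuclideanSpace.single j (1 : ℝ)‖ ^ 2 = 2 - 2 * h j := by
    rw [norm_sub_sq_real, inner_single_one, hn.1]; simp; ring
  have hs2 : ‖h + EuclideanSpace.single j (1 : ℝ)‖ ^ 2 = 2 + 2 * h j := by
    rw [norm_add_sq_real, inner_single_one, hn.1]; simp; ring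
  refine ⟨j, ?_⟩
  rcases le_total 0 (h j) with h0 | h0
  · left
    rw [abs_of_nonneg h0] at hj2
    refine (abs_le_of_sq_le_sq' ?_ (by positivity)).2
    rw [hs1, mul_pow, hsq]; linarith
  · right
    rw [abs_of_nonpos h0] at hj2
    refine (abs_le_of_sq_le_sq' ?_ (by positivity)).2
    rw [hs2, mul_pow, hsq]; linarith

theorem act_image_unitSphere {U : Matrix (ZMod n) (ZMod n) ℝ} (hU : U.transpose * U = 1) :
    act U '' unitSphere n = unitSphere n := by
  ext h
  constructor
  · rintro ⟨u, hu, rfl⟩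
    exact (norm_act_of_orthogonal hU u).trans hu
  · intro hh
    obtain ⟨u, rfl⟩ := (act_bijective_of_orthogonal hU).2 h
    exact ⟨u, (norm_act_of_orthogonal hU u).symm.trans hh, rfl⟩

variable {Ω : Type*} [MeasurableSpace Ω] {P : Measure Ω} {N : ℕ} {x : Fin N → Ω → Vec n}
  {θ ρ : ℝ} {f : Vec n}

theorem mem_region1_iff (hβ : 0 < θ * (1 - 3 * θ)) (hE : expectedObjective P x = popObjective θ)
    {h : Vec n} : h ∈ region1 P x f ρ ↔ ∃ u, (∃ S : Finset (ZMod n), S.card = 1 ∧ NearFlat ρ S u) ∧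
      act (rotation f) u = h := by
  simp only [region1, Set.mem_image, mem_nearStationary_iff hβ hE]

theorem mem_region2_iff (hβ : 0 < θ * (1 - 3 * θ)) (hE : expectedObjective P x = popObjective θ)
    {h : Vec n} : h ∈ region2 P x f ρ ↔ ∃ u, (∃ S : Finset (ZMod n), 1 < S.card ∧ NearFlat ρ S u) ∧
      act (rotation f) u = h := by
  simp only [region2, Set.mem_image, Set.mem_ofPred_eq, mem_nearStationary_iff hβ hE]
  refine exists_congr fun u => and_congr_left fun _ => ?_
  constructor
  · rintro ⟨r, hr, S, rfl, hS⟩; exact ⟨S, hr, hS⟩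
  · rintro ⟨S, hr, hS⟩; exact ⟨_, hr, S, rfl, hS⟩

theorem mem_region3_iff (hβ : 0 < θ * (1 - 3 * θ)) (hE : expectedObjective P x = popObjective θ)
    {h : Vec n} : h ∈ region3 P x f ρ ↔ ∃ u, (‖u‖ = 1 ∧ ∀ S : Finset (ZMod n), ¬ NearFlat ρ S u) ∧
      act (rotation f) u = h := by
  simp only [region3, Set.mem_image, Set.mem_sdiff, Set.mem_union, Set.mem_ofPred_eq,
    mem_nearStationary_iff hβ hE]
  refine exists_congr fun u => and_congr_left fun _ => and_congr Iff.rfl ?_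
  constructor
  · intro hnot S hS
    have h1 : 1 ≤ S.card := hS.2.1.card_pos
    rcases h1.eq_or_lt with h1 | h1
    · exact hnot (Or.inl ⟨S, h1.symm, hS⟩)
    · exact hnot (Or.inr ⟨_, h1, S, rfl, hS⟩)
  · rintro hnot (⟨S, -, hS⟩ | ⟨-, -, S, -, hS⟩) <;> exact hnot S hS

theorem region_union (hf : ConvInvertible f) :
    region1 P x f ρ ∪ region2 P x f ρ ∪ region3 P x f ρ = unitSphere n := by
  rw [region1, region2, region3, ← Set.image_union, ← Set.image_union, Set.union_sdiff_self,
    Set.union_eq_self_of_subset_left, act_image_unitSphere (rotation_orthogonal hf)]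
  rintro h (hh | ⟨r, -, hh⟩) <;> exact hh.1

theorem disjoint_region1_region2 (hβ : 0 < θ * (1 - 3 * θ))
    (hE : expectedObjective P x = popObjective θ) (hρ0 : 0 < ρ) (hρ : ρ < 1 / 1000)
    (hf : ConvInvertible f) : Disjoint (region1 P x f ρ) (region2 P x f ρ) := by
  rw [Set.disjoint_left]
  intro h h1 h2
  obtain ⟨u, ⟨S, hS, hu⟩, rfl⟩ := (mem_region1_iff hβ hE).1 h1
  obtain ⟨v, ⟨S', hS', hv⟩, huv⟩ := (mem_region2_iff hβ hE).1 h2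
  rw [(act_bijective_of_orthogonal (rotation_orthogonal hf)).1 huv] at hv
  exact not_nearFlat_of_singleton hρ0 hρ hS hu hS' hv

theorem disjoint_region1_region3 (hf : ConvInvertible f) :
    Disjoint (region1 P x f ρ) (region3 P x f ρ) :=
  (Set.disjoint_image_iff (act_bijective_of_orthogonal (rotation_orthogonal hf)).1).2
    (Set.disjoint_sdiff_right.mono_left Set.subset_union_left)

theorem disjoint_region2_region3 (hf : ConvInvertible f) :
    Disjoint (region2 P x f ρ) (region3 P x f ρ) :=
  (Set.disjoint_image_iff (act_bijective_of_orthogonal (rotation_orthogonal hf)).1).2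
    (Set.disjoint_sdiff_right.mono_left Set.subset_union_right)

end Regions

/-! ### Sample size and failure probability. -/

section SampleSize

/-- The union bound for the moments is effective at the prescribed sample size. -/
theorem failure_probability_le {β ρ n N : ℝ} (hβ : 0 < β) (hρ0 : 0 < ρ) (hρ : ρ < 1 / 1000)
    (hn : 4 ≤ n) (hN : 49152 / β ^ 2 * n ^ 9 / ρ ^ 4 * Real.log (n / ρ) < N) :
    (n ^ 4 + n ^ 2) * (2 * Real.exp (-(N * (β * ρ ^ 2 / (64 * n ^ 3)) ^ 2) / (2 * n ^ 2))) ≤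
      n ^ (-1 : ℝ) := by
  have hn0 : 0 < n := by linarith
  have hlog : 0 < Real.log n := Real.log_pos (by linarith)
  have hlog2 : Real.log n ≤ n * Real.log (n / ρ) := by
    have h1 : Real.log n ≤ Real.log (n / ρ) :=
      Real.log_le_log hn0 (by rw [le_div_iff₀ hρ0]; nlinarith)
    nlinarith
  -- The constant is $49152=6\cdot8192$ with $8192=2\cdot64^2$, so the exponent exceeds
  -- $6n\log(n/\rho)\ge6\log n$ in size.
  have hexp : Real.exp (-(N * (β * ρ ^ 2 / (64 * n ^ 3)) ^ 2) / (2 * n ^ 2)) ≤ (n ^ 6)⁻¹ := by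
    have h1 : (n ^ 6)⁻¹ = Real.exp (-(6 * Real.log n)) := by
      rw [Real.exp_neg, show 6 * Real.log n = Real.log (n ^ 6) by rw [Real.log_pow]; norm_num,
        Real.exp_log (by positivity)]
    rw [h1, Real.exp_le_exp]
    have h2 : -(N * (β * ρ ^ 2 / (64 * n ^ 3)) ^ 2) / (2 * n ^ 2) =
        -(N * (β ^ 2 * ρ ^ 4 / (8192 * n ^ 8))) := by
      field_simp; ring
    have h3 : 6 * (n * Real.log (n / ρ)) = 49152 / β ^ 2 * n ^ 9 / ρ ^ 4 * Real.log (n / ρ) *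
        (β ^ 2 * ρ ^ 4 / (8192 * n ^ 8)) := by
      field_simp; ring
    have h4 := mul_le_mul_of_nonneg_right hN.le
      (by positivity : 0 ≤ β ^ 2 * ρ ^ 4 / (8192 * n ^ 8))
    rw [h2]
    linarith
  have h5 : n ^ 2 ≤ n ^ 4 := pow_le_pow_right₀ (by linarith) (by norm_num)
  -- The bound is $4/n^2$, at most $1/n$ because $n\ge4$.
  calc _ ≤ (n ^ 4 + n ^ 4) * (2 * (n ^ 6)⁻¹) := by gcongr
    _ = 4 / n * n⁻¹ := by field_simp; norm_num
    _ ≤ 1 * n⁻¹ := by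
        gcongr
        rwa [div_le_one hn0]
    _ = _ := by rw [one_mul, Real.rpow_neg_one]

end SampleSize

end

end MSBD

/-! ### Assembly of the theorem. -/

theorem theorem1 (θ : ℝ) (hθ : θ < 1 / 3) :
    ∃ c₁ c₁' : ℝ, 0 < c₁ ∧ 0 < c₁' ∧
      ∀ (n N : ℕ) [NeZero n] (f : MSBD.Vec n) (ρ : ℝ)
        {Ω : Type*} [MeasurableSpace Ω] (P : Measure Ω) [IsProbabilityMeasure P]
        (x : Fin N → Ω → MSBD.Vec n),
        1 / (n : ℝ) ≤ θ →
        0 < ρ → ρ < 1 / 1000 →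
        MSBD.IsBernoulliRademacher P θ x →
        MSBD.ConvInvertible f →
        max (c₁ * (n : ℝ) ^ 9 / ρ ^ 4 * Real.log (n / ρ))
            (c₁ * MSBD.condNumber f ^ 8 * (n : ℝ) ^ 8 / ρ ^ 4 * Real.log n) < (N : ℝ) →
        0 < MSBD.gap n θ ρ ∧
        -- the three sets partition the sphere
        MSBD.region1 P x f ρ ∪ MSBD.region2 P x f ρ ∪ MSBD.region3 P x f ρ
          = MSBD.unitSphere n ∧
        Disjoint (MSBD.region1 P x f ρ) (MSBD.region2 P x f ρ) ∧
        Disjoint (MSBD.region1 P x f ρ) (MSBD.region3 P x f ρ) ∧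
        Disjoint (MSBD.region2 P x f ρ) (MSBD.region3 P x f ρ) ∧
        ∃ E : Set Ω, MeasurableSet E ∧
          ENNReal.ofReal (1 - (n : ℝ) ^ (-c₁')) ≤ P E ∧
          ∀ ω ∈ E, ∀ y : Fin N → MSBD.Vec n, (∀ i, y i = MSBD.circConv (x i ω) f) →
            -- the preconditioner is well defined
            (MSBD.gramMatrix θ y).PosDef ∧
            -- local minima are close to signed shifted versions of the ground truth
            (∀ h, MSBD.IsSphereLocalMin (MSBD.objective θ y) h → ∃ j : ZMod n,
              ‖MSBD.act (MSBD.circ f) (MSBD.act (MSBD.preconditioner θ y) h)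
                  - EuclideanSpace.single j 1‖ ≤ 2 * √ρ ∨
              ‖MSBD.act (MSBD.circ f) (MSBD.act (MSBD.preconditioner θ y) h)
                  + EuclideanSpace.single j 1‖ ≤ 2 * √ρ) ∧
            -- positive curvature, negative curvature, large gradient
            (∀ h ∈ MSBD.region1 P x f ρ, ∃ m : ℝ,
              IsLeast (MSBD.tangentCurvatures (MSBD.objective θ y) h) m ∧
                MSBD.gap n θ ρ ≤ m) ∧
            (∀ h ∈ MSBD.region2 P x f ρ, ∃ m : ℝ,
              IsLeast (MSBD.tangentCurvatures (MSBD.objective θ y) h) m ∧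
                m ≤ -MSBD.gap n θ ρ) ∧
            (∀ h ∈ MSBD.region3 P x f ρ,
              MSBD.gap n θ ρ ≤ ‖MSBD.riemGrad (MSBD.objective θ y) h‖) ∧
            -- classification of the stationary points
            (∀ h, MSBD.IsStationary (MSBD.objective θ y) h →
              h ∈ MSBD.region1 P x f ρ ∪ MSBD.region2 P x f ρ ∧
              (h ∈ MSBD.region1 P x f ρ → MSBD.IsSphereLocalMin (MSBD.objective θ y) h) ∧
              (h ∈ MSBD.region2 P x f ρ → MSBD.IsStrictSaddle (MSBD.objective θ y) h)) := by
  -- For $\theta\le0$ no $n$ satisfies $1/n\le\theta$, so any constants serve.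
  rcases le_or_gt θ 0 with hneg | hθ0
  · refine ⟨1, 1, one_pos, one_pos, ?_⟩
    intro n N _ f ρ Ω _ P _ x hθn
    have : 0 < 1 / (n : ℝ) := one_div_pos.2 (Nat.cast_pos.2 (NeZero.pos n))
    linarith
  have hβ : 0 < θ * (1 - 3 * θ) := mul_pos hθ0 (by linarith)
  refine ⟨49152 / (θ * (1 - 3 * θ)) ^ 2, 1, by positivity, one_pos, ?_⟩
  intro n N _ f ρ Ω _ P _ x hθn hρ0 hρ hx hf hN
  have hn0 : (0 : ℝ) < n := Nat.cast_pos.2 (NeZero.pos n)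
  -- $1/n\le\theta<1/3$ excludes $n\le3$.
  have hn4 : 4 ≤ n := by
    have h1 : 1 / (n : ℝ) < 1 / 3 := hθn.trans_lt hθ
    rw [div_lt_div_iff_of_pos_left one_pos hn0 (by norm_num)] at h1
    have : 3 < n := by exact_mod_cast h1
    omega
  have hn4' : (4 : ℝ) ≤ n := by exact_mod_cast hn4
  have hN1 := (le_max_left _ _).trans_lt hN
  have hNpos : 0 < N := by
    have h1 : 1 < n / ρ := by rw [lt_div_iff₀ hρ0]; linarith
    have h2 := Real.log_pos h1
    have h3 : (0 : ℝ) < N := lt_trans (by positivity) hN1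
    exact_mod_cast h3
  have hfam := hx.isSparseFamily hθ0.le (by linarith)
  have hE := hfam.expectedObjective_eq hNpos
  have hU := MSBD.rotation_orthogonal hf
  have hgap : 0 < MSBD.gap n θ ρ := by rw [MSBD.gap]; positivity
  have hunion := MSBD.region_union (P := P) (x := x) (ρ := ρ) hf
  refine ⟨hgap, hunion, MSBD.disjoint_region1_region2 hβ hE hρ0 hρ hf,
    MSBD.disjoint_region1_region3 hf, MSBD.disjoint_region2_region3 hf, ?_⟩
  obtain ⟨E, hEm, hEP, hEω⟩ := hfam.exists_event_moments_close hNpos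
    (τ := θ * (1 - 3 * θ) * ρ ^ 2 / (64 * n ^ 3)) (by positivity)
  refine ⟨E, hEm, ?_, ?_⟩
  · refine ENNReal.ofReal_le_of_le_toReal ?_
    have := MSBD.failure_probability_le hβ hρ0 hρ hn4' hN1
    rw [← measureReal_def]
    linarith
  intro ω hω y hy
  obtain rfl : y = fun i => MSBD.circConv (x i ω) f := funext hy
  obtain ⟨hpd, hclose, a, hobj, ha⟩ := MSBD.objective_near_population hθ hn4 hθn hρ0 hρ hf
    (hEω ω hω).1 (hEω ω hω).2
  rw [hobj]
  have hcurv1 : ∀ h ∈ MSBD.region1 P x f ρ, ∀ z, ‖z‖ = 1 → inner ℝ z h = 0 →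
      MSBD.gap n θ ρ ≤ inner ℝ z (MSBD.riemHess (MSBD.quartic (1 / N) a) h z) := by
    intro h hh z hz1 hz
    obtain ⟨u, ⟨S, hS, hu⟩, rfl⟩ := (MSBD.mem_region1_iff hβ hE).1 hh
    exact MSBD.gap_le_curvature hβ hρ0 hρ hn4 hU ha hS hu hz1 hz
  have hcurv2 : ∀ h ∈ MSBD.region2 P x f ρ,
      ∃ q ∈ MSBD.tangentCurvatures (MSBD.quartic (1 / N) a) h, q ≤ -MSBD.gap n θ ρ := by
    intro h hh
    obtain ⟨u, ⟨S, hS, hu⟩, rfl⟩ := (MSBD.mem_region2_iff hβ hE).1 hh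
    obtain ⟨z, hz1, hz, hq⟩ := MSBD.exists_curvature_le_neg_gap hβ hρ0 hρ hn4 hU ha hS hu
    exact ⟨_, ⟨z, hz1, hz, rfl⟩, hq⟩
  have hgrad3 : ∀ h ∈ MSBD.region3 P x f ρ,
      MSBD.gap n θ ρ ≤ ‖MSBD.riemGrad (MSBD.quartic (1 / N) a) h‖ := by
    intro h hh
    obtain ⟨u, ⟨hu, hfar⟩, rfl⟩ := (MSBD.mem_region3_iff hβ hE).1 hh
    exact MSBD.gap_le_norm_riemGrad hβ hρ0 hρ hn4 hU ha hu hfar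
  have hstat : ∀ h, MSBD.IsStationary (MSBD.quartic (1 / N) a) h →
      h ∈ MSBD.region1 P x f ρ ∪ MSBD.region2 P x f ρ := by
    intro h hs
    have hmem := hs.1
    rw [← hunion] at hmem
    refine hmem.resolve_right fun h3 => ?_
    have := hgrad3 h h3
    rw [hs.2, norm_zero] at this
    linarith
  have hleast : ∀ h ∈ MSBD.unitSphere n,
      ∃ m, IsLeast (MSBD.tangentCurvatures (MSBD.quartic (1 / N) a) h) m := fun h hh =>
    MSBD.exists_isLeast_tangentCurvatures _ a h (MSBD.exists_unit_tangent (by omega) hh)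
  refine ⟨hpd, fun h hm => ?_, fun h hh => ?_, fun h hh => ?_, hgrad3, fun h hs =>
    ⟨hstat h hs, fun h1 => ?_, fun h2 => ?_⟩⟩
  · rcases hstat h (MSBD.isStationary_of_isSphereLocalMin _ a hm) with h1 | h2
    · obtain ⟨u, ⟨S, hS, hu⟩, rfl⟩ := (MSBD.mem_region1_iff hβ hE).1 h1
      -- With $h=Uu$ the vector to locate is $Mu$: it is within $\frac12\sqrt\rho$ of `u`, which is
      -- within $\frac32\sqrt\rho$ of a signed basis vector.
      have hMu := hclose u
      rw [hu.1, mul_one] at hMu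
      obtain ⟨j, hj⟩ := MSBD.nearFlat_singleton_close hρ0 hρ hS hu
      refine ⟨j, hj.imp (fun hj => ?_) (fun hj => ?_)⟩
      · refine (norm_sub_le_norm_sub_add_norm_sub _ u _).trans ?_
        linarith
      · rw [← sub_neg_eq_add] at hj ⊢
        refine (norm_sub_le_norm_sub_add_norm_sub _ u _).trans ?_
        linarith
    -- Negative curvature contradicts the second-order necessary condition, so a local minimum
    -- cannot lie in the saddle region.
    · obtain ⟨q, ⟨z, hz1, hz, rfl⟩, hq⟩ := hcurv2 h h2
      have := (MSBD.necessary_conditions_of_isSphereLocalMin _ a hm hz1 hz).2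
      linarith
  · obtain ⟨m, hm⟩ := hleast h (hunion ▸ Or.inl (Or.inl hh))
    refine ⟨m, hm, ?_⟩
    obtain ⟨z, hz1, hz, rfl⟩ := hm.1
    exact hcurv1 h hh z hz1 hz
  · obtain ⟨m, hm⟩ := hleast h (hunion ▸ Or.inl (Or.inr hh))
    obtain ⟨q, hq, hqle⟩ := hcurv2 h hh
    exact ⟨m, hm, (hm.2 hq).trans hqle⟩
  · exact MSBD.isSphereLocalMin_of_curvature_pos _ a hs hgap (hcurv1 h h1)
  · obtain ⟨q, hq, hqle⟩ := hcurv2 h h2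
    exact MSBD.isStrictSaddle_of_curvature_neg _ a hs hq (by linarith)
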